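/- Let $n\ge 0$. A rook of size $n$ is a word $r=r_1\cdots r_n$ over $\{0,1,\dots,n\}$ in which every nonzero letter occurs at most once; $R_n$ denotes the set of rooks of size $n$ and $1_n = 12\cdots n$. Let $R_n^0$ be the monoid with generators $\pi_1,\dots,\pi_{n-1},P_1,\dots,P_n$ and relations $\pi_i^2=\pi_i$; $\ \pi_i\pi_{i+1}\pi_i=\pi_{i+1}\pi_i\pi_{i+1}$; $\ \pi_i\pi_j=\pi_j\pi_i$ for $|i-j|\ge 2$; $\ P_i^2=P_i$; $\ P_iP_j=P_jP_i$; $\ P_i\pi_j=\pi_jP_i$ for $i<j$; $\ P_i\pi_j=\pi_jP_i=P_i$ for $j<i$; $\ P_{i+1}=P_i\pi_iP_i$ for $1\le i<n$ (for all indices for which the generators exist). Put $\pi_0=P_1$. Let $F_n^0$ be the monoid of maps $R_n\to R_n$, written on the right, that is generated by $P_1\colon r_1r_2\cdots r_n\mapsto 0\,r_2\cdots r_n$ and, for $1\le k\le n-1$, by the map $\pi_k$ which exchanges $r_k$ and $r_{k+1}$ if $r_k<r_{k+1}$ and fixes $r$ otherwise. The code $\mathrm{code}(r)\in\mathbb Z^n$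 of a rook $r$ is defined recursively: the code of the empty word is empty. If $n$ occurs in $r=b\,n\,e$, then $\mathrm{code}(r)$ is $\mathrm{code}(be)$ followed by $\ell(b)+1$. Otherwise $r=b\,0\,e$ with no $0$ in $b$, and $\mathrm{code}(r)$ is $\mathrm{code}(be)$ followed by $-\ell(b)$. (Here $\ell$ is the length of a word.) If $\mathrm{code}(r)=c_1\cdots c_n$, put $\pi_r = C_0(c_1)\,C_1(c_2)\cdots C_{n-1}(c_n)\in R_n^0$, where $C_m(i)=1$ if $i>m$, $C_m(i)=\pi_m\pi_{m-1}\cdots\pi_i$ if $0\le i\le m$, and $C_m(i)=\pi_m\cdots\pi_1\pi_0\pi_1\cdots\pi_{-i}$ if $i<0$. For a rook $r$ let $\mathrm{supp}(r)$ be the set of its nonzero letters, let $\mathrm{Inv}(r)=\{(r_i,r_j) : i<j,\ r_i>r_j>0\}$, and for $\ell\in\mathrm{supp}(r)$ let $Z_r(\ell)$ be the number of zeros after $\ell$ in $r$. Write $r\le_I u$ if $\mathrm{supp}(r)\subseteq\mathrm{supp}(u)$, $\{(b,a)\in\mathrm{Inv}(u) : b\in\mathrm{supp}(r)\}\subseteq\mathrm{Inv}(r)$,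 and $Z_u(\ell)\le Z_r(\ell)$ for all $\ell\in\mathrm{supp}(r)$. In a monoid $M$ write $x\le_{\mathcal R}y$ if $xM\subseteq yM$. $M$ is called $\mathcal R$-trivial (respectively $\mathcal L$-trivial, $\mathcal J$-trivial) if $xM=yM$ (respectively $Mx=My$, $MxM=MyM$) implies $x=y$. Then: 1. There is an isomorphism $R_n^0\cong F_n^0$ that sends $\pi_k$ to $\pi_k$ ($1\le k\le n-1$) and $P_1$ to $P_1$ (if $n\ge1$); for the resulting right action of $R_n^0$ on $R_n$ and every rook $r$, $\pi_r$ is the unique element of $R_n^0$ with $1_n\cdot\pi_r=r$. 2. For all $r,u\in R_n$: $\ \pi_r\le_{\mathcal R}\pi_u$ if and only if $r\le_I u$. 3. $R_n^0$ is $\mathcal R$-trivial. 4. $R_n^0$ is isomorphic to its opposite monoid. 5. $R_n^0$ is $\mathcal L$-trivial and $\mathcal J$-trivial. -/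

import Mathlib

/-! ### Green's relations on a monoid -/

namespace Green

variable {M : Type*} [Monoid M]

/-- The right ideal `xM` generated by `x`. -/
def rightIdeal (x : M) : Set M := {z | ∃ m : M, z = x * m}

/-- The left ideal `Mx` generated by `x`. -/
def leftIdeal (x : M) : Set M := {z | ∃ m : M, z = m * x}

/-- The two-sided ideal `MxM` generated by `x`. -/
def twoSidedIdeal (x : M) : Set M := {z | ∃ m m' : M, z = m * x * m'}

/-- Green's `R`-preorder: `x ≤_R y` iff `xM ⊆ yM`. -/
def RLE (x y : M) : Prop := rightIdeal x ⊆ rightIdeal y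

/-- All `R`-classes are singletons. -/
def RTrivial (M : Type*) [Monoid M] : Prop :=
  ∀ x y : M, rightIdeal x = rightIdeal y → x = y

/-- All `L`-classes are singletons. -/
def LTrivial (M : Type*) [Monoid M] : Prop :=
  ∀ x y : M, leftIdeal x = leftIdeal y → x = y

/-- All `J`-classes are singletons. -/
def JTrivial (M : Type*) [Monoid M] : Prop :=
  ∀ x y : M, twoSidedIdeal x = twoSidedIdeal y → x = y

end Green

/-! ### Rooks -/

/-- A rook of size `n`, given by its rook vector: a word of length `n` over `{0, 1, …, n}` in
which every nonzero letter occurs at most once. The `i`-th letter is the index of the row that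
contains the `1` of the `i`-th column of the rook matrix, and `0` if that column is zero.
Positions are numbered from `0` in the code, letters are `1, …, n`. -/
@[ext] structure Rook (n : ℕ) where
  /-- the letters of the rook vector -/
  letter : Fin n → ℕ
  letter_le : ∀ i, letter i ≤ n
  eq_of_letter_eq : ∀ i j, letter i = letter j → letter i ≠ 0 → i = j

namespace Rook

variable {n : ℕ}

/-- The identity rook `1 2 … n`. -/
def one (n : ℕ) : Rook n where
  letter i := i.val + 1
  letter_le i := i.isLt
  eq_of_letter_eq _ _ h _ := Fin.ext (Nat.succ.inj h)

/-- `r · s_k`: exchange the `k`-th and `(k+1)`-st letters, `1 ≤ k ≤ n - 1`. -/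
def actS (k : ℕ) (_hk : 1 ≤ k) (hkn : k < n) (r : Rook n) : Rook n where
  letter i := r.letter (Equiv.swap (⟨k - 1, by omega⟩ : Fin n) ⟨k, hkn⟩ i)
  letter_le i := r.letter_le _
  eq_of_letter_eq i j h h0 :=
    (Equiv.swap (⟨k - 1, by omega⟩ : Fin n) ⟨k, hkn⟩).injective (r.eq_of_letter_eq _ _ h h0)

/-- `r · π_k`: exchange the `k`-th and `(k+1)`-st letters if `r_k < r_{k+1}`, and do nothing
otherwise, `1 ≤ k ≤ n - 1`. -/
def actPi (k : ℕ) (hk : 1 ≤ k) (hkn : k < n) (r : Rook n) : Rook n :=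
  if r.letter ⟨k - 1, by omega⟩ < r.letter ⟨k, hkn⟩ then r.actS k hk hkn else r

/-- `r · P_1`: replace the first letter by `0`. -/
def actP1 (r : Rook n) : Rook n where
  letter i := if i.val = 0 then 0 else r.letter i
  letter_le i := by
    split_ifs
    · exact Nat.zero_le n
    · exact r.letter_le i
  eq_of_letter_eq i j h h0 := by
    by_cases hi : i.val = 0
    · simp [hi] at h0
    · by_cases hj : j.val = 0
      · simp [hi, hj] at h h0
        exact absurd h h0
      · simp only [hi, hj, if_false] at h h0
        exact r.eq_of_letter_eq i j h h0

/-- The support: the set of nonzero letters of `r`. -/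
def supp (r : Rook n) : Set ℕ := {l | l ≠ 0 ∧ ∃ i, r.letter i = l}

/-- The set of inversions of `r`: the pairs of letters `(r_i, r_j)` with `i < j` and
`r_i > r_j > 0`. -/
def inv (r : Rook n) : Set (ℕ × ℕ) :=
  {p | ∃ i j : Fin n, i < j ∧ r.letter j < r.letter i ∧ 0 < r.letter j ∧
    p = (r.letter i, r.letter j)}

/-- `Z_r(l)`: the number of zeros that appear after the letter `l` in `r`. -/
def zerosAfter (r : Rook n) (l : ℕ) : ℕ :=
  (Finset.univ.filter fun j : Fin n => r.letter j = 0 ∧ ∃ i, i < j ∧ r.letter i = l).card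

/-- The combinatorial relation `r ≤_I u`. -/
def LEI (r u : Rook n) : Prop :=
  r.supp ⊆ u.supp ∧
  {p : ℕ × ℕ | p ∈ u.inv ∧ p.1 ∈ r.supp} ⊆ r.inv ∧
  ∀ l ∈ r.supp, u.zerosAfter l ≤ r.zerosAfter l

/-- The recursive computation of the code of a word of length `n`. If the letter `n` occurs, write
the word `b n e`, and append `ℓ(b) + 1` to the code of `b e`. Otherwise write the word `b 0 e` with
no `0` in `b`, and append `-ℓ(b)` to the code of `b e`. -/
def wordCode : ℕ → List ℕ → List ℤ
  | 0, _ => []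
  | n + 1, w =>
    if n + 1 ∈ w then wordCode n (w.erase (n + 1)) ++ [((w.idxOf (n + 1) : ℕ) : ℤ) + 1]
    else wordCode n (w.erase 0) ++ [-((w.idxOf 0 : ℕ) : ℤ)]

/-- The code of a rook, a word of length `n` over `ℤ`. -/
def code (r : Rook n) : List ℤ := wordCode n (List.ofFn r.letter)

end Rook

/-! ### The 0-rook monoid -/

/-- The generators `π_1, …, π_{n-1}` and `P_1, …, P_n`. -/
inductive RookGen (n : ℕ) : Type
  | pi (i : ℕ) (h₁ : 1 ≤ i) (h₂ : i < n) : RookGen n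
  | P (i : ℕ) (h₁ : 1 ≤ i) (h₂ : i ≤ n) : RookGen n

namespace RookGen

variable {n : ℕ}

/-- The generator `π_i` as a word of length one. -/
def wpi (i : ℕ) (h₁ : 1 ≤ i) (h₂ : i < n) : FreeMonoid (RookGen n) := FreeMonoid.of (pi i h₁ h₂)

/-- The generator `P_i` as a word of length one. -/
def wP (i : ℕ) (h₁ : 1 ≤ i) (h₂ : i ≤ n) : FreeMonoid (RookGen n) := FreeMonoid.of (P i h₁ h₂)

end RookGen

open RookGen in
/-- The defining relations of the 0-rook monoid. -/
inductive RookRel (n : ℕ) : FreeMonoid (RookGen n) → FreeMonoid (RookGen n) → Prop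
  | pi_sq (i : ℕ) (h₁ : 1 ≤ i) (h₂ : i < n) :
      RookRel n (wpi i h₁ h₂ * wpi i h₁ h₂) (wpi i h₁ h₂)
  | pi_braid (i : ℕ) (h₁ : 1 ≤ i) (h₂ : i + 1 < n) :
      RookRel n
        (wpi i h₁ (Nat.lt_of_succ_lt h₂) * wpi (i + 1) (Nat.le_add_left 1 i) h₂ *
          wpi i h₁ (Nat.lt_of_succ_lt h₂))
        (wpi (i + 1) (Nat.le_add_left 1 i) h₂ * wpi i h₁ (Nat.lt_of_succ_lt h₂) *
          wpi (i + 1) (Nat.le_add_left 1 i) h₂)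
  | pi_comm (i j : ℕ) (hi₁ : 1 ≤ i) (hi₂ : i < n) (hj₁ : 1 ≤ j) (hj₂ : j < n)
      (hij : i + 2 ≤ j ∨ j + 2 ≤ i) :
      RookRel n (wpi i hi₁ hi₂ * wpi j hj₁ hj₂) (wpi j hj₁ hj₂ * wpi i hi₁ hi₂)
  | P_sq (i : ℕ) (h₁ : 1 ≤ i) (h₂ : i ≤ n) :
      RookRel n (wP i h₁ h₂ * wP i h₁ h₂) (wP i h₁ h₂)
  | P_comm (i j : ℕ) (hi₁ : 1 ≤ i) (hi₂ : i ≤ n) (hj₁ : 1 ≤ j) (hj₂ : j ≤ n) :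
      RookRel n (wP i hi₁ hi₂ * wP j hj₁ hj₂) (wP j hj₁ hj₂ * wP i hi₁ hi₂)
  | P_pi_comm (i j : ℕ) (hi₁ : 1 ≤ i) (hi₂ : i ≤ n) (hj₁ : 1 ≤ j) (hj₂ : j < n) (hij : i < j) :
      RookRel n (wP i hi₁ hi₂ * wpi j hj₁ hj₂) (wpi j hj₁ hj₂ * wP i hi₁ hi₂)
  | P_pi (i j : ℕ) (hi₁ : 1 ≤ i) (hi₂ : i ≤ n) (hj₁ : 1 ≤ j) (hj₂ : j < n) (hij : j < i) :
      RookRel n (wP i hi₁ hi₂ * wpi j hj₁ hj₂) (wP i hi₁ hi₂)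
  | pi_P (i j : ℕ) (hi₁ : 1 ≤ i) (hi₂ : i ≤ n) (hj₁ : 1 ≤ j) (hj₂ : j < n) (hij : j < i) :
      RookRel n (wpi j hj₁ hj₂ * wP i hi₁ hi₂) (wP i hi₁ hi₂)
  | P_succ (i : ℕ) (h₁ : 1 ≤ i) (h₂ : i < n) :
      RookRel n (wP (i + 1) (Nat.le_add_left 1 i) h₂)
        (wP i h₁ (Nat.le_of_lt h₂) * wpi i h₁ h₂ * wP i h₁ (Nat.le_of_lt h₂))

/-- The 0-rook monoid, given by generators and relations. -/
abbrev ZeroRook (n : ℕ) : Type := PresentedMonoid (RookRel n)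

namespace ZeroRook

variable {n : ℕ}

/-- The generator `π_i` of the 0-rook monoid. -/
def pi (i : ℕ) (h₁ : 1 ≤ i) (h₂ : i < n) : ZeroRook n :=
  PresentedMonoid.of (RookRel n) (RookGen.pi i h₁ h₂)

/-- The generator `P_i` of the 0-rook monoid. -/
def P (i : ℕ) (h₁ : 1 ≤ i) (h₂ : i ≤ n) : ZeroRook n :=
  PresentedMonoid.of (RookRel n) (RookGen.P i h₁ h₂)

/-- `π_k` for `0 ≤ k ≤ n - 1`, where `π_0 = P_1`. The value for `k ≥ n` is irrelevant. -/
def piZero (n k : ℕ) : ZeroRook n :=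
  if h : k < n then
    if h₁ : 1 ≤ k then pi k h₁ h else P 1 le_rfl (Nat.one_le_of_lt h)
  else 1

/-- The word of indices of the column attached to `m` and `i`: it is empty for `i > m`, it is
`m, m - 1, …, i` for `0 ≤ i ≤ m`, and it is `m, …, 1, 0, 1, …, -i` for `i < 0`. -/
def columnWord (m : ℕ) (i : ℤ) : List ℕ :=
  if (m : ℤ) < i then []
  else if 0 ≤ i then (List.range' i.toNat (m + 1 - i.toNat)).reverse
  else (List.range (m + 1)).reverse ++ List.range' 1 (-i).toNat

/-- The column as an element of the 0-rook monoid. -/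
def column (n m : ℕ) (i : ℤ) : ZeroRook n := ((columnWord m i).map (piZero n)).prod

/-- `π_c`, the product of the columns for `(0, c_1), (1, c_2), …, (n - 1, c_n)`. -/
def ofCode (n : ℕ) (c : List ℤ) : ZeroRook n :=
  (c.zipIdx.map fun p => column n p.2 p.1).prod

/-- The element `π_r` attached to a rook `r`. -/
def ofRook (r : Rook n) : ZeroRook n := ofCode n r.code

end ZeroRook

/-- The monoid of operators on rooks generated by the right actions of `π_1, …, π_{n-1}` and `P_1`.
Operators act on the right, so that the product `f g` means first `f`, then `g`; this is
multiplication in the opposite of `Function.End`. -/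
def rookOperators (n : ℕ) : Submonoid (Function.End (Rook n))ᵐᵒᵖ :=
  Submonoid.closure
    ({f | ∃ (k : ℕ) (h₁ : 1 ≤ k) (h₂ : k < n), f = MulOpposite.op (Rook.actPi k h₁ h₂)} ∪
      {MulOpposite.op Rook.actP1})

/-!
The proof makes `R_n^0` act on rooks on the right and shows that `x ↦ 1_n · x` is a bijection from
`R_n^0` to `R_n` with inverse `r ↦ π_r`.

The action exists because the operators satisfy the defining relations; on letters, `π_k` acts by
maxima and minima. The main point is the multiplication rule `π_r π_k = π_{r · π_k}`
(`ZeroRook.ofWord_mul_piZero`). It is proved by induction on the size of the rook: `π_r` is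
`π_{r'} C` for a smaller rook `r'` and a column `C`, and `C π_k` is either another column, or `C`
itself, or `π_{k'} C` for an index `k'`, and then the induction hypothesis applies to
`π_{r'} π_{k'}`. Two cases, both about two zeros of the rook, need more: the relations
`π_0 π_1 π_0 π_1 = π_0 π_1 π_0 = π_1 π_0 π_1 π_0`, that is, `P_2 π_1 = P_2 = π_1 P_2`
(`zero_mul_up_mul_negColumn_mul` and `negColumn_mul_zero`). The rule gives `x = π_{1_n · x}` for all
`x`, and since every rook is of the form `1_n · x` (`IsRookWord.wordReach`), also `1_n · π_r = r`.

It follows that `π_r ≤_R π_u` means that `r` can be reached from `u` by generators. Every generator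
moves a rook down in `≤_I` (`Rook.LEI_act`). Conversely, if `r <_I u`, then some generator moves `u`
to another rook that is still above `r` (`Rook.LEI.exists_act`). If a letter of `u` is missing in
`r`, the leftmost such letter can be moved to the left or removed. If the letters are the same, then
some ascent of `u` can be exchanged: otherwise comparing `r` and `u` at the first position where
they differ gives a contradiction (`Rook.LEI.eq_of_forall_ascent`). The same comparison shows that
`≤_I` is antisymmetric, which is `R`-triviality.

The defining relations are invariant under the reversal of words, which gives the isomorphism with
the opposite monoid and hence `L`-triviality. A finite monoid that is `R`-trivial and isomorphic to
its opposite is `J`-trivial: from `x = a y b` and `y = c x d` one gets `x = (ac)^k x (db)^k` for all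
`k`, and finiteness gives `x = x (db)^k` for some `k > 0`, so `x d` is `R`-equivalent to `x`, and
dually for `c x`.
-/

/-! ### Columns in a monoid with the relations of the 0-rook monoid -/

/-- A sequence `p 0, p 1, …` in a monoid that satisfies the relations between `π_0 = P_1` and
`π_1, π_2, …`: the 0-Hecke relations, together with `p 0 p 1 p 0 = P_2` absorbing `p 1` on both
sides. -/
structure ZeroRookSeq {M : Type*} [Monoid M] (p : ℕ → M) : Prop where
  idem : ∀ k, p k * p k = p k
  comm : ∀ i j, i + 2 ≤ j → Commute (p i) (p j)
  braid : ∀ i, 1 ≤ i → p i * p (i + 1) * p i = p (i + 1) * p i * p (i + 1)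
  zero_mul_one : p 0 * p 1 * p 0 * p 1 = p 0 * p 1 * p 0
  one_mul_zero : p 1 * p 0 * p 1 * p 0 = p 0 * p 1 * p 0

namespace ZeroRookSeq

variable {M : Type*} [Monoid M] {p : ℕ → M}

/-- The descending product `p (i + l - 1) ⋯ p (i + 1) p i` of `l` factors. -/
def down (p : ℕ → M) (i : ℕ) : ℕ → M
  | 0 => 1
  | l + 1 => p (i + l) * down p i l

/-- The ascending product `p i p (i + 1) ⋯ p (i + l - 1)` of `l` factors. -/
def up (p : ℕ → M) (i : ℕ) : ℕ → M
  | 0 => 1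
  | l + 1 => up p i l * p (i + l)

/-- The column that moves the last of `m + 1` letters to the left, past all but `b` letters. -/
def posColumn (p : ℕ → M) (m b : ℕ) : M := down p (b + 1) (m - b)

/-- The column that moves the last of `m + 1` letters to the front, replaces it by `0`, and moves
this `0` to the right past `j` letters. -/
def negColumn (p : ℕ → M) (m j : ℕ) : M := down p 0 (m + 1) * up p 1 j

theorem down_succ' (i l : ℕ) : down p i (l + 1) = down p (i + 1) l * p i := by
  induction l with
  | zero => simp [down]
  | succ l ih => rw [down, ih, down, mul_assoc, Nat.add_right_comm i 1 l, add_assoc i l 1]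

theorem up_succ' (i l : ℕ) : up p i (l + 1) = p i * up p (i + 1) l := by
  induction l with
  | zero => simp [up]
  | succ l ih => rw [up, ih, up, mul_assoc, Nat.add_right_comm i 1 l, add_assoc i l 1]

theorem down_eq_prod (i l : ℕ) : down p i l = ((List.range' i l).reverse.map p).prod := by
  induction l with
  | zero => rfl
  | succ l ih => simp [down, ih, List.range'_concat]

theorem up_eq_prod (i l : ℕ) : up p i l = ((List.range' i l).map p).prod := by
  induction l with
  | zero => rfl
  | succ l ih => simp [up, ih, List.range'_concat]

variable (hp : ZeroRookSeq p)
include hp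

theorem commute_of_far {i j : ℕ} (h : i + 2 ≤ j ∨ j + 2 ≤ i) : Commute (p i) (p j) :=
  h.elim (hp.comm i j) fun h => (hp.comm j i h).symm

theorem commute_down {i l k : ℕ} (h : k + 2 ≤ i ∨ i + l + 1 ≤ k) : Commute (down p i l) (p k) := by
  induction l with
  | zero => exact Commute.one_left _
  | succ l ih => exact (hp.commute_of_far (by omega)).mul_left (ih (by omega))

theorem commute_up {i l k : ℕ} (h : k + 2 ≤ i ∨ i + l + 1 ≤ k) : Commute (up p i l) (p k) := by
  induction l with
  | zero => exact Commute.one_left _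
  | succ l ih => exact (ih (by omega)).mul_left (hp.commute_of_far (by omega))

/-- A factor slides through a descending product, losing one from its index. -/
theorem down_mul {i l k : ℕ} (hi : 1 ≤ i) (hik : i < k) (hk : k < i + l) :
    down p i l * p k = p (k - 1) * down p i l := by
  induction l with
  | zero => omega
  | succ l ih =>
    rcases Nat.lt_or_ge k (i + l) with h | h
    · rw [down, mul_assoc, ih h, ← mul_assoc, ← mul_assoc,
        (hp.comm (k - 1) (i + l) (by omega)).eq]
    · obtain ⟨l, rfl⟩ : ∃ l', l = l' + 1 := ⟨l - 1, by omega⟩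
      obtain rfl : k = i + l + 1 := by omega
      have hc := (hp.commute_down (i := i) (l := l) (k := i + l + 1) (Or.inr le_rfl)).eq
      have hb := hp.braid (i + l) (by omega)
      simp only [down, Nat.add_sub_cancel, ← add_assoc]
      simp only [mul_assoc, hc]
      simp only [← mul_assoc, ← hb]

/-- A factor slides through an ascending product, gaining one in its index. -/
theorem up_mul {i l k : ℕ} (hi : 1 ≤ i) (hik : i ≤ k) (hk : k + 1 < i + l) :
    up p i l * p k = p (k + 1) * up p i l := by
  induction l with
  | zero => omega
  | succ l ih =>
    rcases Nat.lt_or_ge (k + 1) (i + l) with h | h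
    · rw [up, mul_assoc, ← (hp.comm k (i + l) (by omega)).eq, ← mul_assoc, ih h, mul_assoc]
    · obtain ⟨l, rfl⟩ : ∃ l', l = l' + 1 := ⟨l - 1, by omega⟩
      obtain rfl : k = i + l := by omega
      have hc := (hp.commute_up (i := i) (l := l) (k := i + l + 1) (Or.inr le_rfl)).eq
      have hb := hp.braid (i + l) (by omega)
      simp only [up, ← add_assoc]
      simp only [← mul_assoc, ← hc]
      simp only [mul_assoc] at hb ⊢
      rw [hb]

/-- An ascending product slides through a longer descending product. -/
theorem up_mul_down {j m : ℕ} (h : j < m) : up p 1 j * down p 1 m = down p 1 m * up p 2 j := by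
  induction j with
  | zero => simp [up]
  | succ j ih =>
    have := hp.down_mul (i := 1) (l := m) (k := 2 + j) le_rfl (by omega) (by omega)
    rw [show 2 + j - 1 = 1 + j by omega] at this
    rw [up, mul_assoc, ← this, ← mul_assoc, ih (by omega), up, mul_assoc]

/-- Here `up p 2 j * up p 1 j` moves a pair of letters to the right past `j` letters; exchanging the
pair before or after the move is the same. -/
theorem up_two_mul_up_one_mul (j : ℕ) :
    up p 2 j * up p 1 j * p (j + 1) = p 1 * (up p 2 j * up p 1 j) := by
  induction j with
  | zero => simp [up]
  | succ j ih =>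
    have hc := (hp.commute_up (i := 1) (l := j) (k := j + 2) (by omega)).eq
    have hb := hp.braid (j + 1) (by omega)
    have e : up p 2 (j + 1) * up p 1 (j + 1) = up p 2 j * up p 1 j * (p (j + 2) * p (j + 1)) := by
      rw [up, up, add_comm 2 j, add_comm 1 j, mul_assoc, ← mul_assoc (p (j + 2)), ← hc]
      simp only [mul_assoc]
    rw [e, mul_assoc, ← hb, mul_assoc (p (j + 1)), ← mul_assoc, ih, mul_assoc]

theorem posColumn_mul_of_lt {m b k : ℕ} (h : k < b) :
    posColumn p m b * p k = p k * posColumn p m b :=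
  hp.commute_down (by omega)

omit hp in
theorem posColumn_mul_self {m b : ℕ} (h : b ≤ m) :
    posColumn p m b * p b = down p b (m + 1 - b) := by
  rw [posColumn, ← down_succ', Nat.sub_add_comm h]

theorem posColumn_mul_succ {m b : ℕ} (h : b < m) :
    posColumn p m b * p (b + 1) = posColumn p m b := by
  obtain ⟨l, hl⟩ : ∃ l, m - b = l + 1 := ⟨m - b - 1, by omega⟩
  rw [posColumn, hl, down_succ', mul_assoc, hp.idem]

theorem posColumn_mul_of_gt {m b k : ℕ} (h : b + 1 < k) (hk : k ≤ m) :
    posColumn p m b * p k = p (k - 1) * posColumn p m b :=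
  hp.down_mul (by omega) h (by omega)

omit hp in
theorem negColumn_eq (m j : ℕ) : negColumn p m j = down p 1 m * p 0 * up p 1 j := by
  rw [negColumn, down_succ']

omit hp in
theorem negColumn_mul_succ (m j : ℕ) : negColumn p m j * p (j + 1) = negColumn p m (j + 1) := by
  rw [negColumn, negColumn, up, mul_assoc, add_comm 1 j]

theorem negColumn_mul_self (m j : ℕ) : negColumn p m j * p j = negColumn p m j := by
  cases j with
  | zero => simp [negColumn_eq, up, mul_assoc, hp.idem]
  | succ j => simp only [negColumn, up, mul_assoc, add_comm 1 j, hp.idem]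

theorem negColumn_mul_of_gt {m j k : ℕ} (h : j + 1 < k) (hk : k ≤ m) :
    negColumn p m j * p k = p (k - 1) * negColumn p m j := by
  rw [negColumn_eq, mul_assoc, (hp.commute_up (i := 1) (l := j) (k := k) (by omega)).eq,
    ← mul_assoc, mul_assoc _ (p 0), (hp.comm 0 k (by omega)).eq, ← mul_assoc,
    hp.down_mul le_rfl (by omega) (by omega)]
  simp only [mul_assoc]

theorem negColumn_mul_of_lt {m j k : ℕ} (hk : 1 ≤ k) (h : k < j) (hj : j ≤ m) :
    negColumn p m j * p k = p k * negColumn p m j := by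
  rw [negColumn_eq, mul_assoc, hp.up_mul le_rfl hk (by omega), ← mul_assoc, mul_assoc _ (p 0),
    (hp.comm 0 (k + 1) (by omega)).eq, ← mul_assoc, hp.down_mul le_rfl (by omega) (by omega),
    Nat.add_sub_cancel]
  simp only [mul_assoc]

/-- Two adjacent zeros cannot be exchanged: after a zero has been created and moved past `j`
letters, the column that creates another zero to its left absorbs `p (j + 1)`. -/
theorem zero_mul_up_mul_negColumn_mul {m j : ℕ} (h : j < m) :
    p 0 * up p 1 j * negColumn p m j * p (j + 1) = p 0 * up p 1 j * negColumn p m j := by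
  obtain ⟨m, rfl⟩ : ∃ m', m = m' + 1 := ⟨m - 1, by omega⟩
  have e : p 0 * up p 1 j * negColumn p (m + 1) j =
      down p 2 m * (p 0 * p 1 * p 0) * (up p 2 j * up p 1 j) := by
    have h1 := hp.up_mul_down (j := j) (m := m + 1) h
    have h2 := (hp.commute_up (i := 2) (l := j) (k := 0) (by omega)).eq
    have h3 := (hp.commute_down (i := 2) (l := m) (k := 0) (by omega)).eq
    calc p 0 * up p 1 j * negColumn p (m + 1) j
        = p 0 * (up p 1 j * down p 1 (m + 1)) * p 0 * up p 1 j := by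
          simp only [negColumn_eq, mul_assoc]
      _ = (p 0 * down p 2 m) * p 1 * (up p 2 j * p 0) * up p 1 j := by
          rw [h1, down_succ']; simp only [mul_assoc]
      _ = _ := by rw [h2, ← h3]; simp only [mul_assoc]
  rw [e, mul_assoc, hp.up_two_mul_up_one_mul, ← mul_assoc, mul_assoc _ _ (p 1), hp.zero_mul_one]

/-- Creating a zero at the front and then another one is the same as creating a zero further to the
right, and then replacing the first letter by a zero. -/
theorem negColumn_mul_zero {m j : ℕ} (h : j < m) :
    negColumn p m (j + 1) * p 0 = p 0 * up p 1 j * negColumn p m 0 := by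
  obtain ⟨m, rfl⟩ : ∃ m', m = m' + 1 := ⟨m - 1, by omega⟩
  have h1 := hp.up_mul_down (j := j) (m := m + 1) h
  have h2 := (hp.commute_up (i := 2) (l := j) (k := 0) (by omega)).eq
  have h3 := (hp.commute_down (i := 2) (l := m) (k := 0) (by omega)).eq
  have h4 := hp.one_mul_zero
  calc negColumn p (m + 1) (j + 1) * p 0
      = down p 2 m * p 1 * p 0 * p 1 * (up p 2 j * p 0) := by
        rw [negColumn_eq, up_succ', down_succ']; simp only [mul_assoc]
    _ = down p 2 m * (p 1 * p 0 * p 1 * p 0) * up p 2 j := by rw [h2]; simp only [mul_assoc]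
    _ = (down p 2 m * p 0) * p 1 * (p 0 * up p 2 j) := by rw [h4]; simp only [mul_assoc]
    _ = p 0 * (down p 1 (m + 1) * up p 2 j) * p 0 := by
        rw [h3, ← h2, down_succ']; simp only [mul_assoc]
    _ = p 0 * up p 1 j * negColumn p (m + 1) 0 := by
        rw [← h1, negColumn_eq, up]; simp only [mul_assoc, mul_one]

end ZeroRookSeq

/-! ### Generation of the 0-rook monoid by `π_0, …, π_{n-1}` -/

namespace ZeroRook

variable {n : ℕ}

theorem piZero_of_pos {k : ℕ} (h₁ : 1 ≤ k) (h₂ : k < n) : piZero n k = pi k h₁ h₂ := by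
  simp [piZero, h₁, h₂]

theorem piZero_zero (h : 1 ≤ n) : piZero n 0 = P 1 le_rfl h := by
  have h' : 0 < n := h
  simp [piZero, h']

theorem piZero_of_le {k : ℕ} (h : n ≤ k) : piZero n k = 1 := by
  simp [piZero, h.not_gt]

theorem P_succ (i : ℕ) (h₁ : 1 ≤ i) (h₂ : i < n) :
    (P (i + 1) (Nat.le_add_left 1 i) h₂ : ZeroRook n) =
      P i h₁ (Nat.le_of_lt h₂) * pi i h₁ h₂ * P i h₁ (Nat.le_of_lt h₂) :=
  PresentedMonoid.mk_eq_mk_of_rel (RookRel.P_succ i h₁ h₂)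

/-- The relations hold for all indices, since `piZero n k = 1` for `k ≥ n`. -/
theorem zeroRookSeq (n : ℕ) : ZeroRookSeq (piZero n) where
  idem k := by
    rcases Nat.lt_or_ge k n with h | h
    · rcases Nat.eq_zero_or_pos k with rfl | hk
      · rw [piZero_zero h]
        exact PresentedMonoid.mk_eq_mk_of_rel (RookRel.P_sq 1 le_rfl h)
      · rw [piZero_of_pos hk h]
        exact PresentedMonoid.mk_eq_mk_of_rel (RookRel.pi_sq k hk h)
    · simp [piZero_of_le h]
  comm i j hij := by
    rcases Nat.lt_or_ge j n with h | h
    · rcases Nat.eq_zero_or_pos i with rfl | hi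
      · rw [piZero_zero (by omega), piZero_of_pos (by omega) h]
        exact PresentedMonoid.mk_eq_mk_of_rel
          (RookRel.P_pi_comm 1 j le_rfl (by omega) (by omega) h (by omega))
      · rw [piZero_of_pos hi (by omega), piZero_of_pos (by omega) h]
        exact PresentedMonoid.mk_eq_mk_of_rel
          (RookRel.pi_comm i j hi (by omega) (by omega) h (Or.inl hij))
    · rw [piZero_of_le h]
      exact Commute.one_right _
  braid i hi := by
    rcases Nat.lt_or_ge (i + 1) n with h | h
    · rw [piZero_of_pos hi (by omega), piZero_of_pos (by omega) h]
      exact PresentedMonoid.mk_eq_mk_of_rel (RookRel.pi_braid i hi h)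
    · rcases Nat.lt_or_ge i n with h' | h'
      · rw [piZero_of_le h, piZero_of_pos hi h', mul_one, one_mul, mul_one]
        exact PresentedMonoid.mk_eq_mk_of_rel (RookRel.pi_sq i hi h')
      · simp [piZero_of_le h, piZero_of_le h']
  zero_mul_one := by
    rcases Nat.lt_or_ge 1 n with h | h
    · rw [piZero_zero h.le, piZero_of_pos le_rfl h, ← P_succ]
      exact PresentedMonoid.mk_eq_mk_of_rel (RookRel.P_pi 2 1 (by omega) h le_rfl h (by omega))
    · simp [piZero_of_le h]
  one_mul_zero := by
    rcases Nat.lt_or_ge 1 n with h | h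
    · rw [piZero_zero h.le, piZero_of_pos le_rfl h, mul_assoc, mul_assoc, ← mul_assoc (P 1 _ _),
        ← P_succ]
      exact PresentedMonoid.mk_eq_mk_of_rel (RookRel.pi_P 2 1 (by omega) h le_rfl h (by omega))
    · simp [piZero_of_le h]

theorem closure_piZero (n : ℕ) :
    Submonoid.closure {x | ∃ k < n, x = piZero n k} = (⊤ : Submonoid (ZeroRook n)) := by
  rw [eq_top_iff, ← PresentedMonoid.closure_range_of, Submonoid.closure_le]
  have hpi (k : ℕ) (h₁ : 1 ≤ k) (h₂ : k < n) :
      pi k h₁ h₂ ∈ Submonoid.closure {x | ∃ k < n, x = piZero n k} :=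
    Submonoid.subset_closure ⟨k, h₂, (piZero_of_pos h₁ h₂).symm⟩
  have hP (k : ℕ) (h₁ : 1 ≤ k) (h₂ : k ≤ n) :
      P k h₁ h₂ ∈ Submonoid.closure {x | ∃ k < n, x = piZero n k} := by
    induction k, h₁ using Nat.le_induction with
    | base => exact Submonoid.subset_closure ⟨0, h₂, (piZero_zero h₂).symm⟩
    | succ k hk ih =>
      rw [P_succ k hk h₂]
      exact mul_mem (mul_mem (ih _) (hpi k hk h₂)) (ih _)
  rintro _ ⟨⟨k, h₁, h₂⟩ | ⟨k, h₁, h₂⟩, rfl⟩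
  · exact hpi k h₁ h₂
  · exact hP k h₁ h₂

theorem induction_piZero {C : ZeroRook n → Prop} (x : ZeroRook n) (one : C 1)
    (mul_piZero : ∀ x k, k < n → C x → C (x * piZero n k)) : C x := by
  have hx : x ∈ Submonoid.closure {x | ∃ k < n, x = piZero n k} := by simp [closure_piZero]
  induction hx using Submonoid.closure_induction_right with
  | one => exact one
  | mul_right x _ y hy ih =>
    obtain ⟨k, hk, rfl⟩ := hy
    exact mul_piZero x k hk ih

/-! ### The anti-automorphism -/

theorem lift_op_eq_of_rel (a b : FreeMonoid (RookGen n)) (h : RookRel n a b) :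
    FreeMonoid.lift (fun g => MulOpposite.op (PresentedMonoid.of (RookRel n) g)) a =
      FreeMonoid.lift (fun g => MulOpposite.op (PresentedMonoid.of (RookRel n) g)) b := by
  have key {u v : FreeMonoid (RookGen n)} (h : RookRel n u v) :=
    PresentedMonoid.mk_eq_mk_of_rel h
  cases h with
  | pi_sq i h₁ h₂ => exact congrArg MulOpposite.op (key (.pi_sq i h₁ h₂))
  | pi_braid i h₁ h₂ =>
    have := key (.pi_braid i h₁ h₂)
    simp only [map_mul, mul_assoc] at this
    exact congrArg MulOpposite.op this
  | pi_comm i j hi₁ hi₂ hj₁ hj₂ hij =>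
    exact congrArg MulOpposite.op (key (.pi_comm i j hi₁ hi₂ hj₁ hj₂ hij)).symm
  | P_sq i h₁ h₂ => exact congrArg MulOpposite.op (key (.P_sq i h₁ h₂))
  | P_comm i j hi₁ hi₂ hj₁ hj₂ =>
    exact congrArg MulOpposite.op (key (.P_comm i j hi₁ hi₂ hj₁ hj₂)).symm
  | P_pi_comm i j hi₁ hi₂ hj₁ hj₂ hij =>
    exact congrArg MulOpposite.op (key (.P_pi_comm i j hi₁ hi₂ hj₁ hj₂ hij)).symm
  | P_pi i j hi₁ hi₂ hj₁ hj₂ hij =>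
    exact congrArg MulOpposite.op (key (.pi_P i j hi₁ hi₂ hj₁ hj₂ hij))
  | pi_P i j hi₁ hi₂ hj₁ hj₂ hij =>
    exact congrArg MulOpposite.op (key (.P_pi i j hi₁ hi₂ hj₁ hj₂ hij))
  | P_succ i h₁ h₂ =>
    have := key (.P_succ i h₁ h₂)
    simp only [map_mul, mul_assoc] at this
    exact congrArg MulOpposite.op this

/-- The homomorphism to the opposite monoid that fixes all generators. It exists because reversing
all words permutes the defining relations. -/
def toOpposite (n : ℕ) : ZeroRook n →* (ZeroRook n)ᵐᵒᵖ :=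
  PresentedMonoid.lift (fun g => MulOpposite.op (PresentedMonoid.of (RookRel n) g))
    lift_op_eq_of_rel

theorem toOpposite_unop_toOpposite (x : ZeroRook n) :
    toOpposite n (toOpposite n x).unop = MulOpposite.op x := by
  have hx : x ∈ Submonoid.closure (Set.range (PresentedMonoid.of (RookRel n))) := by simp
  induction hx using Submonoid.closure_induction with
  | mem x hx =>
    obtain ⟨g, rfl⟩ := hx
    rfl
  | one => simp
  | mul x y _ _ hx hy => simp [hx, hy]

/-- The isomorphism with the opposite monoid that fixes all generators. -/
def equivOpposite (n : ℕ) : ZeroRook n ≃* (ZeroRook n)ᵐᵒᵖ where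
  toFun := toOpposite n
  invFun x := (toOpposite n x.unop).unop
  left_inv x := by simp only [toOpposite_unop_toOpposite, MulOpposite.unop_op]
  right_inv x := by simp only [toOpposite_unop_toOpposite, MulOpposite.op_unop]
  map_mul' := map_mul _

end ZeroRook

/-! ### The action on rooks -/

namespace Rook

variable {n : ℕ}

/-- `r · P_m`: replace the first `m` letters by `0`. -/
def actP (m : ℕ) (r : Rook n) : Rook n where
  letter i := if i.val < m then 0 else r.letter i
  letter_le i := by
    split_ifs
    · exact Nat.zero_le n
    · exact r.letter_le i
  eq_of_letter_eq i j h h0 := by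
    split_ifs at h h0
    · exact absurd rfl h0
    · exact absurd h.symm (by simp_all)
    · exact absurd h h0
    · exact r.eq_of_letter_eq i j h h0

theorem actP_one : actP (n := n) 1 = actP1 := by
  funext r
  ext i
  simp [actP, actP1]

/-- The letter of `r` at position `i`, and `0` for `i ≥ n`. -/
def get (r : Rook n) (i : ℕ) : ℕ := if h : i < n then r.letter ⟨i, h⟩ else 0

theorem letter_eq_get (r : Rook n) (i : Fin n) : r.letter i = r.get i := by simp [get]

theorem ext_get {r u : Rook n} (h : ∀ i < n, r.get i = u.get i) : r = u := by
  ext i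
  rw [letter_eq_get, letter_eq_get, h i i.isLt]

theorem get_of_le (r : Rook n) {i : ℕ} (h : n ≤ i) : r.get i = 0 := by
  simp [get, h.not_gt]

theorem get_le (r : Rook n) (i : ℕ) : r.get i ≤ n := by
  unfold get
  split_ifs
  · exact r.letter_le _
  · exact Nat.zero_le n

theorem get_inj (r : Rook n) {i j : ℕ} (h : r.get i = r.get j) (h0 : r.get i ≠ 0) : i = j := by
  rcases Nat.lt_or_ge i n with hi | hi
  · rcases Nat.lt_or_ge j n with hj | hj
    · simp only [get, hi, hj, dif_pos] at h h0
      exact congrArg Fin.val (r.eq_of_letter_eq _ _ h h0)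
    · exact absurd (h.trans (r.get_of_le hj)) h0
  · exact absurd (r.get_of_le hi) h0

theorem get_actP (r : Rook n) (m i : ℕ) : (r.actP m).get i = if i < m then 0 else r.get i := by
  simp only [get, actP]
  split_ifs <;> rfl

theorem get_actPi (r : Rook n) (k : ℕ) (hk : 1 ≤ k) (hkn : k < n) (i : ℕ) :
    (r.actPi k hk hkn).get i =
      if i + 1 = k then max (r.get i) (r.get k)
      else if i = k then min (r.get (k - 1)) (r.get k) else r.get i := by
  rcases Nat.lt_or_ge i n with hi | hi
  · have h1 : k - 1 < n := by omega
    simp only [get, hi, hkn, h1, dif_pos, actPi]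
    by_cases h2 : r.letter ⟨k - 1, h1⟩ < r.letter ⟨k, hkn⟩
    · simp only [h2, if_true, actS]
      by_cases h3 : i + 1 = k
      · obtain rfl : i = k - 1 := by omega
        simp [h3, h2.le]
      · by_cases h4 : i = k
        · subst h4
          simp [h2.le]
        · rw [Equiv.swap_apply_of_ne_of_ne] <;> simp [Fin.ext_iff, h3, h4]
          omega
    · simp only [h2, if_false]
      by_cases h3 : i + 1 = k
      · obtain rfl : i = k - 1 := by omega
        simp [h3, not_lt.1 h2]
      · by_cases h4 : i = k
        · subst h4
          simp [not_lt.1 h2]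
        · simp [h3, h4]
  · rw [get_of_le _ hi, get_of_le _ hi]
    split_ifs <;> omega

end Rook

namespace ZeroRook

variable {n : ℕ}

/-- The operator by which a generator acts on rooks on the right. -/
def genAct : RookGen n → (Function.End (Rook n))ᵐᵒᵖ
  | .pi k h₁ h₂ => MulOpposite.op (Rook.actPi k h₁ h₂)
  | .P k _ _ => MulOpposite.op (Rook.actP k)

theorem unop_genAct_pi (k : ℕ) (h₁ : 1 ≤ k) (h₂ : k < n) (r : Rook n) :
    (genAct (.pi k h₁ h₂)).unop r = r.actPi k h₁ h₂ := rfl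

theorem unop_genAct_P (k : ℕ) (h₁ : 1 ≤ k) (h₂ : k ≤ n) (r : Rook n) :
    (genAct (.P k h₁ h₂)).unop r = r.actP k := rfl

theorem unop_mul_apply (f g : (Function.End (Rook n))ᵐᵒᵖ) (r : Rook n) :
    (f * g).unop r = g.unop (f.unop r) := rfl

theorem lift_genAct_eq_of_rel (a b : FreeMonoid (RookGen n)) (h : RookRel n a b) :
    FreeMonoid.lift genAct a = FreeMonoid.lift genAct b := by
  apply MulOpposite.unop_injective
  funext r
  apply Rook.ext_get
  intro i hi
  cases h <;>
    simp only [RookGen.wpi, RookGen.wP, map_mul, FreeMonoid.lift_eval_of, unop_genAct_pi,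
      unop_genAct_P, unop_mul_apply, Rook.get_actP, Rook.get_actPi] <;> grind

/-- The right action of the 0-rook monoid on rooks. -/
def actHom (n : ℕ) : ZeroRook n →* (Function.End (Rook n))ᵐᵒᵖ :=
  PresentedMonoid.lift genAct lift_genAct_eq_of_rel

end ZeroRook

/-! ### The action on words -/

/-- The action of `π_k` on words: `π_0` replaces the first letter by `0`, and `π_k` puts the `k`-th
and the `(k+1)`-st letters into decreasing order. -/
def wordAct : ℕ → List ℕ → List ℕ
  | 0, _ :: w => 0 :: w
  | 1, x :: y :: w => max x y :: min x y :: w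
  | k + 2, x :: w => x :: wordAct (k + 1) w
  | _, w => w

/-- The words that are rooks of size `m`. -/
structure IsRookWord (m : ℕ) (w : List ℕ) : Prop where
  length_eq : w.length = m
  le : ∀ a ∈ w, a ≤ m
  count_le : ∀ a, a ≠ 0 → w.count a ≤ 1

@[simp] theorem wordAct_nil (k : ℕ) : wordAct k [] = [] := by
  rcases k with _ | _ | k <;> simp [wordAct]

@[simp] theorem wordAct_zero_cons (x : ℕ) (w : List ℕ) : wordAct 0 (x :: w) = 0 :: w := by
  simp [wordAct]

@[simp] theorem wordAct_one_cons_cons (x y : ℕ) (w : List ℕ) :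
    wordAct 1 (x :: y :: w) = max x y :: min x y :: w := by
  simp [wordAct]

@[simp] theorem wordAct_cons (k x : ℕ) (w : List ℕ) :
    wordAct (k + 2) (x :: w) = x :: wordAct (k + 1) w := by
  simp [wordAct]

theorem wordAct_succ_perm (k : ℕ) (w : List ℕ) : (wordAct (k + 1) w).Perm w := by
  induction k generalizing w with
  | zero =>
    match w with
    | [] => simp
    | [x] => simp [wordAct]
    | x :: y :: w =>
      rcases le_total x y with h | h
      · simpa [h] using List.Perm.swap x y w
      · simp [h]
  | succ k ih =>
    cases w with
    | nil => simp
    | cons x w => simpa using ih w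

theorem length_wordAct (k : ℕ) (w : List ℕ) : (wordAct k w).length = w.length := by
  cases k with
  | zero => cases w <;> simp
  | succ k => exact (wordAct_succ_perm k w).length_eq

theorem wordAct_append_of_lt {k : ℕ} {b : List ℕ} (h : k < b.length) (e : List ℕ) :
    wordAct k (b ++ e) = wordAct k b ++ e := by
  induction b generalizing k with
  | nil => simp at h
  | cons x b ih =>
    match k with
    | 0 => simp
    | 1 =>
      cases b with
      | nil => simp at h
      | cons y b => simp
    | k + 2 => simpa using ih (by rw [List.length_cons] at h; omega)

theorem wordAct_append_add (b : List ℕ) (k : ℕ) (e : List ℕ) :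
    wordAct (b.length + (k + 1)) (b ++ e) = b ++ wordAct (k + 1) e := by
  induction b with
  | nil => simp
  | cons x b ih =>
    rw [List.length_cons, show b.length + 1 + (k + 1) = b.length + k + 2 by omega,
      List.cons_append, wordAct_cons, List.cons_append, ← ih, add_assoc]

/-- The action of `π_k` on the `k`-th and `(k+1)`-st letters. -/
theorem wordAct_append_cons_cons (b : List ℕ) (x y : ℕ) (e : List ℕ) :
    wordAct (b.length + 1) (b ++ x :: y :: e) = b ++ max x y :: min x y :: e := by
  rw [wordAct_append_add b 0, wordAct_one_cons_cons]

theorem mem_of_mem_wordAct {k a : ℕ} {w : List ℕ} (h : a ∈ wordAct k w) (ha : a ≠ 0) : a ∈ w := by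
  cases k with
  | zero => cases w <;> simp_all
  | succ k => exact (wordAct_succ_perm k w).mem_iff.1 h

theorem IsRookWord.wordAct {m : ℕ} {w : List ℕ} (hw : IsRookWord m w) (k : ℕ) :
    IsRookWord m (wordAct k w) where
  length_eq := by rw [length_wordAct, hw.length_eq]
  le := by
    cases k with
    | zero =>
      cases w with
      | nil => simp
      | cons x w =>
        have := hw.le
        simp only [List.mem_cons, forall_eq_or_imp] at this
        simpa using this.2
    | succ k => exact fun a ha => hw.le a ((wordAct_succ_perm k w).mem_iff.1 ha)
  count_le a ha := by
    cases k with
    | zero =>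
      cases w with
      | nil => simp
      | cons x w =>
        have := hw.count_le a ha
        rw [List.count_cons] at this
        rw [wordAct_zero_cons, List.count_cons_of_ne ha.symm]
        omega
    | succ k =>
      rw [(wordAct_succ_perm k w).count_eq]
      exact hw.count_le a ha

theorem IsRookWord.perm {m : ℕ} {w v : List ℕ} (hw : IsRookWord m w) (h : v.Perm w) :
    IsRookWord m v where
  length_eq := by rw [h.length_eq, hw.length_eq]
  le a ha := hw.le a (h.mem_iff.1 ha)
  count_le a ha := by
    rw [h.count_eq]
    exact hw.count_le a ha

/-- Removing the largest letter. -/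
theorem IsRookWord.remove_max {m : ℕ} {b e : List ℕ} (hw : IsRookWord (m + 1) (b ++ (m + 1) :: e)) :
    IsRookWord m (b ++ e) ∧ m + 1 ∉ b ++ e := by
  have hc := hw.count_le (m + 1) (by omega)
  rw [List.count_append, List.count_cons_self] at hc
  have hmem : m + 1 ∉ b ++ e := by
    rw [← List.count_eq_zero, List.count_append]
    omega
  refine ⟨⟨?_, fun a ha => ?_, fun a ha => ?_⟩, hmem⟩
  · have := hw.length_eq
    simp only [List.length_append, List.length_cons] at this ⊢
    omega
  · have h1 := hw.le a (by simp only [List.mem_append, List.mem_cons] at ha ⊢; tauto)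
    have h2 : a ≠ m + 1 := by rintro rfl; exact hmem ha
    omega
  · have := hw.count_le a ha
    rw [List.count_append, List.count_cons] at this
    rw [List.count_append]
    omega

/-- Removing a zero from a word in which the largest possible letter does not occur. -/
theorem IsRookWord.remove_zero {m : ℕ} {b e : List ℕ} (hw : IsRookWord (m + 1) (b ++ 0 :: e))
    (hmem : m + 1 ∉ b ++ e) : IsRookWord m (b ++ e) := by
  refine ⟨?_, fun a ha => ?_, fun a ha => ?_⟩
  · have := hw.length_eq
    simp only [List.length_append, List.length_cons] at this ⊢
    omega
  · have h1 := hw.le a (by simp only [List.mem_append, List.mem_cons] at ha ⊢; tauto)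
    have h2 : a ≠ m + 1 := by rintro rfl; exact hmem ha
    omega
  · have := hw.count_le a ha
    rw [List.count_append, List.count_cons] at this
    rw [List.count_append]
    omega

/-- A rook word of size `m + 1` contains the letter `m + 1` or, by the pigeonhole principle, the
letter `0`. -/
theorem IsRookWord.exists_eq_append {m : ℕ} {w : List ℕ} (hw : IsRookWord (m + 1) w) :
    (∃ b e, w = b ++ (m + 1) :: e) ∨ m + 1 ∉ w ∧ ∃ b e, w = b ++ 0 :: e ∧ 0 ∉ b := by
  by_cases h : m + 1 ∈ w
  · exact Or.inl (List.append_of_mem h)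
  · refine Or.inr ⟨h, ?_⟩
    have h0 : 0 ∈ w := by
      by_contra h0
      have hnd : w.Nodup := by
        rw [List.nodup_iff_count_le_one]
        intro a
        rcases eq_or_ne a 0 with rfl | ha
        · simp [List.count_eq_zero.2 h0]
        · exact hw.count_le a ha
      have hsub : w ⊆ List.range' 1 m := by
        intro a ha
        have h1 := hw.le a ha
        have h2 : a ≠ m + 1 := by rintro rfl; exact h ha
        have h3 : a ≠ 0 := by rintro rfl; exact h0 ha
        rw [List.mem_range'_1]
        omega
      have := (hnd.subperm hsub).length_le
      rw [hw.length_eq, List.length_range'] at this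
      omega
    obtain ⟨b, e, hb, hw', -⟩ := List.exists_erase_eq h0
    exact ⟨b, e, hw', hb⟩

/-! ### The elements attached to words -/

namespace ZeroRook

open ZeroRookSeq

variable {n : ℕ}

/-- The element attached to a word of length `m ≤ n` that is a rook of size `m`. -/
def ofWord (n m : ℕ) (w : List ℕ) : ZeroRook n := ofCode n (Rook.wordCode m w)

theorem ofCode_append_singleton (c : List ℤ) (i : ℤ) :
    ofCode n (c ++ [i]) = ofCode n c * column n c.length i := by
  simp [ofCode, List.zipIdx_append]

theorem length_wordCode (m : ℕ) (w : List ℕ) : (Rook.wordCode m w).length = m := by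
  induction m generalizing w with
  | zero => simp [Rook.wordCode]
  | succ m ih =>
    rw [Rook.wordCode]
    split_ifs <;> simp [ih]

theorem column_of_nonneg (m b : ℕ) : column n m b = down (piZero n) b (m + 1 - b) := by
  rw [down_eq_prod, column, columnWord]
  by_cases h : (m : ℤ) < b
  · rw [if_pos h, show m + 1 - b = 0 by omega]
    rfl
  · simp [h]

theorem column_pos (m b : ℕ) : column n m ((b : ℤ) + 1) = posColumn (piZero n) m b := by
  rw [posColumn, show (b : ℤ) + 1 = ((b + 1 : ℕ) : ℤ) by simp, column_of_nonneg]
  simp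

theorem column_neg (m j : ℕ) : column n m (-(j : ℤ)) = negColumn (piZero n) m j := by
  cases j with
  | zero =>
    have := column_of_nonneg (n := n) m 0
    simpa [negColumn, up] using this
  | succ j =>
    rw [negColumn, down_eq_prod, up_eq_prod, column, columnWord, if_neg (by omega),
      if_neg (by omega), List.map_append, List.prod_append, List.range_eq_range']
    simp

theorem ofWord_max {m : ℕ} {b e : List ℕ} (hb : m + 1 ∉ b) :
    ofWord n (m + 1) (b ++ (m + 1) :: e) =
      ofWord n m (b ++ e) * posColumn (piZero n) m b.length := by
  rw [ofWord, Rook.wordCode, if_pos (by simp), ofCode_append_singleton, length_wordCode,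
    List.erase_append_right _ hb, List.erase_cons_head, List.idxOf_append_of_notMem hb,
    List.idxOf_cons_self, add_zero, column_pos, ofWord]

theorem ofWord_zero {m : ℕ} {b e : List ℕ} (hbe : m + 1 ∉ b ++ e) (hb : 0 ∉ b) :
    ofWord n (m + 1) (b ++ 0 :: e) =
      ofWord n m (b ++ e) * negColumn (piZero n) m b.length := by
  rw [ofWord, Rook.wordCode, if_neg (by simp_all), ofCode_append_singleton, length_wordCode,
    List.erase_append_right _ hb, List.erase_cons_head, List.idxOf_append_of_notMem hb,
    List.idxOf_cons_self, add_zero, column_neg, ofWord]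

/-- The factors `π_{l+1}, …, π_{l+l'}` move a zero at the position `l + 1` past `l'` letters. The
multiplication rule for words of length `m` is a hypothesis, since this is used in its proof by
induction on `m`. -/
theorem ofWord_mul_up {m : ℕ}
    (ih : ∀ w, IsRookWord m w → ∀ k < m, ofWord n m w * piZero n k = ofWord n m (wordAct k w))
    (c b e : List ℕ) (hw : IsRookWord m (c ++ 0 :: (b ++ e))) :
    ofWord n m (c ++ 0 :: (b ++ e)) * up (piZero n) (c.length + 1) b.length =
      ofWord n m (c ++ (b ++ 0 :: e)) := by
  induction b generalizing c with
  | nil => simp [up]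
  | cons x b ihb =>
    have hl := hw.length_eq
    simp only [List.length_append, List.length_cons] at hl
    have h1 := ih _ hw (c.length + 1) (by omega)
    rw [List.cons_append, wordAct_append_cons_cons, Nat.zero_max, Nat.zero_min] at h1
    have h2 := ihb (c ++ [x]) (hw.perm (by simpa using (List.Perm.swap 0 x _).append_left c))
    rw [List.length_cons, up_succ', ← mul_assoc, List.cons_append, h1]
    simpa using h2

/-- The induction step of the multiplication rule for a word `b (m+1) e`: the generator acts inside
`b`, on the letter `m + 1`, or inside `e`. -/
theorem ofWord_max_mul_piZero {m : ℕ}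
    (ih : ∀ w, IsRookWord m w → ∀ k < m, ofWord n m w * piZero n k = ofWord n m (wordAct k w))
    {b e : List ℕ} (hw : IsRookWord (m + 1) (b ++ (m + 1) :: e)) {k : ℕ} (hk : k < m + 1) :
    ofWord n (m + 1) (b ++ (m + 1) :: e) * piZero n k =
      ofWord n (m + 1) (wordAct k (b ++ (m + 1) :: e)) := by
  have hp := zeroRookSeq n
  obtain ⟨hbe, hmem⟩ := hw.remove_max
  have hb : m + 1 ∉ b := fun h => hmem (List.mem_append_left _ h)
  have hl := hbe.length_eq
  rw [List.length_append] at hl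
  rw [ofWord_max hb, mul_assoc]
  rcases lt_trichotomy k b.length with h | rfl | h
  · rw [hp.posColumn_mul_of_lt h, ← mul_assoc, ih _ hbe k (by omega), wordAct_append_of_lt h,
      wordAct_append_of_lt h, ofWord_max fun h => hb (mem_of_mem_wordAct h (by omega)),
      length_wordAct]
  · rw [posColumn_mul_self (by omega)]
    rcases List.eq_nil_or_concat b with rfl | ⟨b, x, rfl⟩
    · have := ofWord_zero (n := n) (m := m) (b := []) (e := e) (by simpa using hmem) (by simp)
      simpa [negColumn, up] using this.symm
    · have hx : x ≤ m := hbe.le x (by simp)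
      have hb' : m + 1 ∉ b := fun h => hb (by simp [h])
      have := wordAct_append_cons_cons b x (m + 1) e
      rw [max_eq_right (by omega), min_eq_left (by omega)] at this
      simp only [List.concat_eq_append, List.append_assoc, List.singleton_append,
        List.length_append, List.length_singleton]
      rw [this, ofWord_max hb', posColumn, Nat.add_sub_add_right]
  · obtain ⟨l, rfl⟩ := Nat.exists_eq_add_of_lt h
    obtain ⟨x, e, rfl⟩ : ∃ x e', e = x :: e' := List.exists_cons_of_length_pos (by omega)
    cases l with
    | zero =>
      have hx : x ≤ m := hbe.le x (by simp)
      rw [add_zero, hp.posColumn_mul_succ (by omega), wordAct_append_cons_cons,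
        max_eq_left (by omega), min_eq_right (by omega), ofWord_max hb]
    | succ l =>
      rw [hp.posColumn_mul_of_gt (by omega) (by omega), ← mul_assoc, Nat.add_sub_cancel,
        ih _ hbe _ (by omega), wordAct_append_add, add_assoc, wordAct_append_add, wordAct_cons,
        ofWord_max hb]

/-- The induction step of the multiplication rule for a word `b 0 e` in which the letter `m + 1`
does not occur and `0` is the leftmost zero. -/
theorem ofWord_zero_mul_piZero {m : ℕ}
    (ih : ∀ w, IsRookWord m w → ∀ k < m, ofWord n m w * piZero n k = ofWord n m (wordAct k w))
    {b e : List ℕ} (hw : IsRookWord (m + 1) (b ++ 0 :: e)) (hmem : m + 1 ∉ b ++ 0 :: e)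
    (hb0 : 0 ∉ b) {k : ℕ} (hk : k < m + 1) :
    ofWord n (m + 1) (b ++ 0 :: e) * piZero n k = ofWord n (m + 1) (wordAct k (b ++ 0 :: e)) := by
  have hp := zeroRookSeq n
  have hm : m + 1 ∉ b ++ e := fun h => hmem (by simp at h ⊢; tauto)
  have hbe := hw.remove_zero hm
  have hl := hbe.length_eq
  rw [List.length_append] at hl
  rw [ofWord_zero hm hb0, mul_assoc]
  rcases lt_trichotomy k b.length with h | rfl | h
  · cases k with
    | zero =>
      -- `π_0` makes the first letter of `b` the leftmost zero, so that the column changes.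
      obtain ⟨x, b, rfl⟩ := List.exists_cons_of_length_pos h
      rw [List.length_cons] at hl
      have h1 := ih _ hbe 0 (by omega)
      rw [List.cons_append, wordAct_zero_cons] at h1
      have hbe' := hbe.wordAct 0
      rw [List.cons_append, wordAct_zero_cons] at hbe'
      have h2 := ofWord_mul_up ih [] b e hbe'
      have h3 := ofWord_zero (n := n) (m := m) (b := []) (e := b ++ 0 :: e)
        (fun h => hmem (by simp at h ⊢; tauto)) (by simp)
      rw [List.length_cons, hp.negColumn_mul_zero (by omega), ← mul_assoc, ← mul_assoc,
        List.cons_append, h1]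
      simp only [List.nil_append, List.length_nil, zero_add] at h2 h3
      rw [h2, List.cons_append, wordAct_zero_cons, h3]
    | succ k =>
      rw [hp.negColumn_mul_of_lt (by omega) h (by omega), ← mul_assoc, ih _ hbe _ (by omega),
        wordAct_append_of_lt h, wordAct_append_of_lt h, ofWord_zero, length_wordAct]
      · rw [← wordAct_append_of_lt h]
        exact fun h => hm (mem_of_mem_wordAct h (by omega))
      · rwa [(wordAct_succ_perm k b).mem_iff]
  · rw [hp.negColumn_mul_self, ← ofWord_zero hm hb0]
    rcases List.eq_nil_or_concat b with rfl | ⟨b, x, rfl⟩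
    · simp
    · have := wordAct_append_cons_cons b x 0 e
      rw [Nat.max_zero, Nat.min_zero] at this
      simp only [List.concat_eq_append, List.append_assoc, List.singleton_append,
        List.length_append, List.length_singleton]
      rw [this]
  · obtain ⟨l, rfl⟩ := Nat.exists_eq_add_of_lt h
    obtain ⟨x, e, rfl⟩ : ∃ x e', e = x :: e' := List.exists_cons_of_length_pos (by omega)
    cases l with
    | zero =>
      rw [add_zero, wordAct_append_cons_cons, Nat.zero_max, Nat.zero_min]
      rcases eq_or_ne x 0 with rfl | hx
      · -- The remaining word `b 0 e` is the image of `0 b e`, which `π_0` fixes.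
        have hv : IsRookWord m ([] ++ 0 :: (b ++ e)) := hbe.perm List.perm_middle.symm
        have h1 := ih _ hv 0 (by omega)
        rw [List.nil_append, wordAct_zero_cons] at h1
        have h2 := ofWord_mul_up ih [] b e hv
        simp only [List.nil_append, List.length_nil, zero_add] at h2
        have h3 := hp.zero_mul_up_mul_negColumn_mul (m := m) (j := b.length) (by
          rw [List.length_cons] at hl; omega)
        rw [ofWord_zero hm hb0, ← h2, ← h1]
        simp only [mul_assoc] at h3 ⊢
        rw [h3]
      · have := ofWord_zero (n := n) (m := m) (b := b ++ [x]) (e := e) (by simpa using hm)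
          (by simp [hb0, hx.symm])
        rw [negColumn_mul_succ]
        simpa using this.symm
    | succ l =>
      rw [hp.negColumn_mul_of_gt (by omega) (by omega), ← mul_assoc, Nat.add_sub_cancel,
        ih _ hbe _ (by omega), wordAct_append_add, add_assoc, wordAct_append_add, wordAct_cons,
        ofWord_zero _ hb0]
      rw [← wordAct_append_add]
      exact fun h => hm (mem_of_mem_wordAct h (by omega))

/-- The multiplication rule: the element attached to a word, multiplied by a generator, is the
element attached to the image of the word. -/
theorem ofWord_mul_piZero {m : ℕ} {w : List ℕ} (hw : IsRookWord m w) {k : ℕ} (hk : k < m) :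
    ofWord n m w * piZero n k = ofWord n m (wordAct k w) := by
  induction m generalizing w k with
  | zero => omega
  | succ m ih =>
    rcases hw.exists_eq_append with ⟨b, e, rfl⟩ | ⟨hmem, b, e, rfl, hb0⟩
    · exact ofWord_max_mul_piZero (fun _ h _ hk => ih h hk) hw hk
    · exact ofWord_zero_mul_piZero (fun _ h _ hk => ih h hk) hw hmem hb0 hk

/-- The element attached to the identity word is the identity. -/
theorem ofWord_range' (m : ℕ) : ofWord n m (List.range' 1 m) = 1 := by
  induction m with
  | zero => simp [ofWord, Rook.wordCode, ofCode]
  | succ m ih =>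
    have h := ofWord_max (n := n) (m := m) (b := List.range' 1 m) (e := [])
      (by rw [List.mem_range'_1]; omega)
    rw [List.append_nil, ih, one_mul, List.length_range', posColumn, Nat.sub_self] at h
    rw [List.range'_concat, one_mul, add_comm 1 m, h, down]

end ZeroRook

/-! ### Every rook is an image of the identity -/

/-- The reachability of words under the action of `π_0, …, π_{m-1}`. -/
def WordReach (m : ℕ) : List ℕ → List ℕ → Prop :=
  Relation.ReflTransGen fun w v => ∃ k < m, v = wordAct k w

theorem WordReach.move_left {m x : ℕ} (b e : List ℕ) (h : ∀ y ∈ e, y ≤ x)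
    (hm : b.length + e.length < m) : WordReach m (b ++ (e ++ [x])) (b ++ x :: e) := by
  induction e generalizing b with
  | nil => exact .refl
  | cons y e ih =>
    rw [List.length_cons] at hm
    have h1 := ih (b ++ [y]) (fun z hz => h z (by simp [hz])) (by
      rw [List.length_append, List.length_singleton]; omega)
    have h2 := wordAct_append_cons_cons b y x e
    rw [max_eq_right (h y (by simp)), min_eq_left (h y (by simp))] at h2
    simp only [List.append_assoc, List.singleton_append] at h1
    exact h1.tail ⟨b.length + 1, by omega, h2.symm⟩

theorem WordReach.move_right {m : ℕ} (b c e : List ℕ) (hm : b.length + c.length < m) :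
    WordReach m (b ++ 0 :: (c ++ e)) (b ++ (c ++ 0 :: e)) := by
  induction c generalizing b with
  | nil => exact .refl
  | cons y c ih =>
    rw [List.length_cons] at hm
    have h1 := ih (b ++ [y]) (by rw [List.length_append, List.length_singleton]; omega)
    have h2 := wordAct_append_cons_cons b 0 y (c ++ e)
    rw [Nat.zero_max, Nat.zero_min] at h2
    simp only [List.append_assoc, List.singleton_append] at h1
    exact .head ⟨b.length + 1, by omega, h2.symm⟩ h1

theorem WordReach.append_singleton {m x : ℕ} {w v : List ℕ} (h : WordReach m w v)
    (hw : w.length = m) : WordReach (m + 1) (w ++ [x]) (v ++ [x]) := by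
  suffices WordReach (m + 1) (w ++ [x]) (v ++ [x]) ∧ v.length = m from this.1
  induction h with
  | refl => exact ⟨.refl, hw⟩
  | tail _ hv ih =>
    obtain ⟨k, hk, rfl⟩ := hv
    refine ⟨ih.1.tail ⟨k, by omega, ?_⟩, by rw [length_wordAct, ih.2]⟩
    rw [wordAct_append_of_lt (by rw [ih.2]; exact hk)]

theorem IsRookWord.wordReach {m : ℕ} {w : List ℕ} (hw : IsRookWord m w) :
    WordReach m (List.range' 1 m) w := by
  induction m generalizing w with
  | zero =>
    rw [List.length_eq_zero_iff.1 hw.length_eq]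
    exact .refl
  | succ m ih =>
    rw [List.range'_concat, one_mul, add_comm 1 m]
    rcases hw.exists_eq_append with ⟨b, e, rfl⟩ | ⟨hmem, b, e, rfl, -⟩
    · have hbe := hw.remove_max.1
      have hl := hbe.length_eq
      rw [List.length_append] at hl
      have h1 := (ih hbe).append_singleton (x := m + 1) List.length_range'
      rw [List.append_assoc] at h1
      exact h1.trans (WordReach.move_left b e
        (fun y hy => (hbe.le y (by simp [hy])).trans (by omega)) (by omega))
    · have hbe := hw.remove_zero fun h => hmem (by simp at h ⊢; tauto)
      have hl := hbe.length_eq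
      have hl' := hl
      rw [List.length_append] at hl'
      have h1 := (ih hbe).append_singleton (x := m + 1) List.length_range'
      have h2 := WordReach.move_left (m := m + 1) (x := m + 1) [] (b ++ e)
        (fun y hy => (hbe.le y hy).trans (by omega)) (by rw [List.length_nil]; omega)
      have h3 := WordReach.move_right (m := m + 1) [] b e (by rw [List.length_nil]; omega)
      exact ((h1.trans h2).tail ⟨0, by omega, by simp⟩).trans h3

/-! ### The regular action -/

namespace Rook

variable {n : ℕ}

/-- The right action of an element of the 0-rook monoid on a rook. -/
def act (r : Rook n) (x : ZeroRook n) : Rook n := (ZeroRook.actHom n x).unop r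

@[simp] theorem act_one (r : Rook n) : r.act 1 = r := by
  rw [act, map_one]
  rfl

@[simp] theorem act_mul (r : Rook n) (x y : ZeroRook n) : r.act (x * y) = (r.act x).act y := by
  rw [act, map_mul]
  rfl

theorem act_piZero_zero (r : Rook n) : r.act (ZeroRook.piZero n 0) = r.actP1 := by
  rcases Nat.eq_zero_or_pos n with rfl | h
  · exact Rook.ext (funext fun i => i.elim0)
  · rw [ZeroRook.piZero_zero h, ← actP_one]
    rfl

theorem act_piZero_of_pos (r : Rook n) {k : ℕ} (h₁ : 1 ≤ k) (h₂ : k < n) :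
    r.act (ZeroRook.piZero n k) = r.actPi k h₁ h₂ := by
  rw [ZeroRook.piZero_of_pos h₁ h₂]
  rfl

theorem get_act_zero (r : Rook n) (i : ℕ) :
    (r.act (ZeroRook.piZero n 0)).get i = if i = 0 then 0 else r.get i := by
  rw [act_piZero_zero, ← actP_one, get_actP]
  simp only [Nat.lt_one_iff]

theorem get_act_of_pos (r : Rook n) {k : ℕ} (h₁ : 1 ≤ k) (h₂ : k < n) (i : ℕ) :
    (r.act (ZeroRook.piZero n k)).get i =
      if i + 1 = k then max (r.get i) (r.get k)
      else if i = k then min (r.get (k - 1)) (r.get k) else r.get i := by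
  rw [act_piZero_of_pos r h₁ h₂, get_actPi]

/-- The rook vector as a list. -/
def word (r : Rook n) : List ℕ := List.ofFn r.letter

theorem word_injective : Function.Injective (word (n := n)) := fun _ _ h =>
  Rook.ext (List.ofFn_injective h)

theorem length_word (r : Rook n) : r.word.length = n := by simp [word]

theorem getElem_word (r : Rook n) (i : ℕ) (h : i < r.word.length) : r.word[i] = r.get i := by
  have : i < n := by rwa [length_word] at h
  simp [word, get, this]

theorem isRookWord_word (r : Rook n) : IsRookWord n r.word where
  length_eq := r.length_word
  le a ha := by
    obtain ⟨i, hi, rfl⟩ := List.getElem_of_mem ha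
    rw [getElem_word]
    exact r.get_le i
  count_le a ha := by
    by_contra h
    obtain ⟨i, j, hij, hi, hj⟩ := List.duplicate_iff_exists_distinct_get.1
      (List.duplicate_iff_two_le_count.2 (not_le.1 h))
    rw [List.get_eq_getElem, getElem_word] at hi hj
    exact hij.ne (Fin.ext (r.get_inj (hi.symm.trans hj) (hi ▸ ha)))

theorem word_one : (one n).word = List.range' 1 n := by
  apply List.ext_getElem
  · simp [length_word]
  · intro i h _
    rw [length_word] at h
    simp [getElem_word, get, one, h, add_comm]

theorem word_act (r : Rook n) {k : ℕ} (hk : k < n) :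
    (r.act (ZeroRook.piZero n k)).word = wordAct k r.word := by
  cases k with
  | zero =>
    obtain ⟨x, w, hw⟩ := List.exists_cons_of_length_pos (l := r.word) (by rwa [length_word])
    have hget (i : ℕ) (h : i < (x :: w).length) : (x :: w)[i] = r.get i := by
      simp only [← hw, getElem_word]
    rw [hw, wordAct_zero_cons]
    apply List.ext_getElem
    · rw [length_word, ← r.length_word, hw]
      rfl
    · intro i h1 h2
      rw [getElem_word, get_act_zero]
      cases i with
      | zero => rfl
      | succ i => exact (hget (i + 1) h2).symm
  | succ k =>
    obtain ⟨x, y, e, hw⟩ : ∃ x y e, r.word = r.word.take k ++ x :: y :: e := by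
      have h1 : k < r.word.length := by rw [length_word]; omega
      have h2 : k + 1 < r.word.length := by rwa [length_word]
      refine ⟨r.word[k], r.word[k + 1], r.word.drop (k + 2), ?_⟩
      rw [← List.drop_eq_getElem_cons h2, ← List.drop_eq_getElem_cons h1, List.take_append_drop]
    generalize hb : r.word.take k = b at hw
    have hbk : b.length = k := by
      rw [← hb, List.length_take, length_word]
      omega
    have hget (i : ℕ) (h : i < (b ++ x :: y :: e).length) : (b ++ x :: y :: e)[i] = r.get i := by
      simp only [← hw, getElem_word]
    have hl := r.length_word
    have hx := hget k (by simp [hbk])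
    have hy := hget (k + 1) (by simp [hbk])
    subst hbk
    rw [hw] at hl ⊢
    rw [wordAct_append_cons_cons]
    apply List.ext_getElem
    · rw [length_word, ← hl]
      simp
    · intro i h1 h2
      rw [length_word] at h1
      rw [getElem_word, get_act_of_pos r (by omega) hk]
      have hi := hget i (by rw [hl]; exact h1)
      grind

end Rook

namespace ZeroRook

variable {n : ℕ}

theorem ofRook_eq (r : Rook n) : ofRook r = ofWord n n r.word := rfl

theorem ofRook_mul (r : Rook n) (x : ZeroRook n) : ofRook r * x = ofRook (r.act x) := by
  induction x using induction_piZero with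
  | one => simp
  | mul_piZero x k hk ih =>
    rw [← mul_assoc, ih, ofRook_eq, ofWord_mul_piZero (Rook.isRookWord_word _) hk, Rook.act_mul,
      ← Rook.word_act _ hk, ofRook_eq]

/-- An element of the 0-rook monoid is determined by the image of the identity rook. -/
theorem ofRook_one_act (x : ZeroRook n) : ofRook ((Rook.one n).act x) = x := by
  rw [← ofRook_mul, ofRook_eq, Rook.word_one, ofWord_range', one_mul]

theorem exists_one_act_eq (r : Rook n) : ∃ x, (Rook.one n).act x = r := by
  suffices ∀ w, WordReach n (List.range' 1 n) w → ∃ x, ((Rook.one n).act x).word = w by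
    obtain ⟨x, hx⟩ := this _ r.isRookWord_word.wordReach
    exact ⟨x, Rook.word_injective hx⟩
  intro w hw
  induction hw with
  | refl => exact ⟨1, by rw [Rook.act_one, Rook.word_one]⟩
  | tail _ h ih =>
    obtain ⟨x, rfl⟩ := ih
    obtain ⟨k, hk, rfl⟩ := h
    exact ⟨x * piZero n k, by rw [Rook.act_mul, Rook.word_act _ hk]⟩

theorem one_act_ofRook (r : Rook n) : (Rook.one n).act (ofRook r) = r := by
  obtain ⟨x, rfl⟩ := exists_one_act_eq r
  rw [ofRook_one_act]

theorem one_act_eq_iff (r : Rook n) (x : ZeroRook n) : (Rook.one n).act x = r ↔ x = ofRook r :=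
  ⟨fun h => by rw [← h, ofRook_one_act], fun h => by rw [h, one_act_ofRook]⟩

theorem one_act_injective : Function.Injective (Rook.one n).act := fun x y h => by
  rw [← ofRook_one_act x, h, ofRook_one_act]

theorem actHom_injective : Function.Injective (actHom n) := fun x y h =>
  one_act_injective (by rw [Rook.act, Rook.act, h])

theorem actHom_piZero_zero : actHom n (piZero n 0) = MulOpposite.op Rook.actP1 :=
  MulOpposite.unop_injective (funext Rook.act_piZero_zero)

theorem actHom_pi (k : ℕ) (h₁ : 1 ≤ k) (h₂ : k < n) :
    actHom n (pi k h₁ h₂) = MulOpposite.op (Rook.actPi k h₁ h₂) := rfl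

theorem mrange_actHom (n : ℕ) : MonoidHom.mrange (actHom n) = rookOperators n := by
  apply le_antisymm
  · rintro _ ⟨x, rfl⟩
    induction x using induction_piZero with
    | one => rw [map_one]; exact one_mem _
    | mul_piZero x k hk ih =>
      rw [map_mul]
      refine mul_mem ih (Submonoid.subset_closure ?_)
      rcases Nat.eq_zero_or_pos k with rfl | h
      · exact Or.inr actHom_piZero_zero
      · exact Or.inl ⟨k, h, hk, by rw [piZero_of_pos h hk, actHom_pi]⟩
  · rw [rookOperators, Submonoid.closure_le]
    rintro _ (⟨k, h₁, h₂, rfl⟩ | rfl)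
    · exact ⟨pi k h₁ h₂, rfl⟩
    · exact ⟨piZero n 0, actHom_piZero_zero⟩

/-- The isomorphism of the 0-rook monoid with the monoid of operators on rooks. -/
noncomputable def equivOperators (n : ℕ) : ZeroRook n ≃* rookOperators n :=
  MulEquiv.ofBijective
    ((actHom n).codRestrict (rookOperators n) fun x =>
      mrange_actHom n ▸ MonoidHom.mem_mrange.2 ⟨x, rfl⟩)
    ⟨fun _ _ h => actHom_injective (congrArg Subtype.val h), fun ⟨f, hf⟩ => by
      rw [← mrange_actHom] at hf
      obtain ⟨x, rfl⟩ := hf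
      exact ⟨x, rfl⟩⟩

theorem coe_equivOperators (x : ZeroRook n) :
    (equivOperators n x : (Function.End (Rook n))ᵐᵒᵖ) = actHom n x := rfl

end ZeroRook

/-! ### The order `≤_I` in terms of positions -/

namespace Rook

variable {n : ℕ}

instance : Finite (Rook n) :=
  Finite.of_injective (fun r (i : Fin n) => (⟨r.letter i, Nat.lt_succ_of_le (r.letter_le i)⟩ :
    Fin (n + 1))) fun _ _ h => Rook.ext (funext fun i => congrArg Fin.val (congrFun h i))

/-- The number of zeros at the positions `i, i + 1, …` of `r`. -/
def zerosFrom (r : Rook n) (i : ℕ) : ℕ := ((Finset.Ico i n).filter fun j => r.get j = 0).card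

theorem zerosFrom_eq (r : Rook n) {i : ℕ} (h : i < n) :
    r.zerosFrom i = r.zerosFrom (i + 1) + if r.get i = 0 then 1 else 0 := by
  rw [zerosFrom, ← Finset.insert_Ico_add_one_left_eq_Ico h, Finset.filter_insert]
  split_ifs
  · rw [Finset.card_insert_of_notMem (by simp), zerosFrom]
  · rfl

theorem zerosFrom_anti (r : Rook n) {i j : ℕ} (h : i ≤ j) : r.zerosFrom j ≤ r.zerosFrom i :=
  Finset.card_le_card (Finset.filter_subset_filter _ (Finset.Ico_subset_Ico_left h))

theorem zerosFrom_congr {r u : Rook n} {i : ℕ} (h : ∀ j, i ≤ j → r.get j = u.get j) :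
    r.zerosFrom i = u.zerosFrom i := by
  rw [zerosFrom, zerosFrom]
  congr 1
  apply Finset.filter_congr
  intro j hj
  rw [h j (Finset.mem_Ico.1 hj).1]

theorem lt_of_get_ne_zero (r : Rook n) {i : ℕ} (h : r.get i ≠ 0) : i < n :=
  not_le.1 fun h' => h (r.get_of_le h')

/-- A rook whose letters occur in another one has at least as many zeros. -/
theorem zerosFrom_zero_le {r u : Rook n} (h : ∀ i, r.get i ≠ 0 → ∃ p, u.get p = r.get i) :
    u.zerosFrom 0 ≤ r.zerosFrom 0 := by
  have hr := Finset.card_filter_add_card_filter_not (s := Finset.Ico 0 n) (fun j => r.get j = 0)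
  have hu := Finset.card_filter_add_card_filter_not (s := Finset.Ico 0 n) (fun j => u.get j = 0)
  have : ((Finset.Ico 0 n).filter fun j => ¬ r.get j = 0).card ≤
      ((Finset.Ico 0 n).filter fun j => ¬ u.get j = 0).card := by
    choose! f hf using h
    apply Finset.card_le_card_of_injOn f
    · intro i hi
      simp only [Finset.coe_filter, Finset.mem_Ico, Set.mem_ofPred_eq] at hi ⊢
      have : u.get (f i) ≠ 0 := by rw [hf i hi.2]; exact hi.2
      exact ⟨⟨Nat.zero_le _, u.lt_of_get_ne_zero this⟩, this⟩
    · intro i hi j hj hij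
      simp only [Finset.coe_filter, Finset.mem_Ico, Set.mem_ofPred_eq] at hi hj
      exact r.get_inj (by rw [← hf i hi.2, ← hf j hj.2, hij]) hi.2
  rw [zerosFrom, zerosFrom]
  omega

theorem mem_supp_iff {r : Rook n} {l : ℕ} : l ∈ r.supp ↔ l ≠ 0 ∧ ∃ i, r.get i = l := by
  refine and_congr_right fun hl => ⟨fun ⟨i, hi⟩ => ⟨i, by rw [← letter_eq_get, hi]⟩, ?_⟩
  rintro ⟨i, rfl⟩
  exact ⟨⟨i, r.lt_of_get_ne_zero hl⟩, letter_eq_get ..⟩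

theorem get_mem_supp {r : Rook n} {i : ℕ} (h : r.get i ≠ 0) : r.get i ∈ r.supp :=
  mem_supp_iff.2 ⟨h, i, rfl⟩

theorem mem_inv_iff {r : Rook n} {b a : ℕ} :
    (b, a) ∈ r.inv ↔ ∃ i j, i < j ∧ a < b ∧ 0 < a ∧ r.get i = b ∧ r.get j = a := by
  constructor
  · rintro ⟨i, j, hij, h1, h2, h3⟩
    obtain ⟨rfl, rfl⟩ := Prod.mk.inj h3
    exact ⟨i, j, hij, h1, h2, by rw [← letter_eq_get], by rw [← letter_eq_get]⟩
  · rintro ⟨i, j, hij, h1, h2, rfl, rfl⟩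
    refine ⟨⟨i, r.lt_of_get_ne_zero (by omega)⟩, ⟨j, r.lt_of_get_ne_zero (by omega)⟩, hij, ?_⟩
    simp only [letter_eq_get]
    exact ⟨h1, h2, trivial⟩

theorem zerosAfter_get {r : Rook n} {i : ℕ} (h : r.get i ≠ 0) :
    r.zerosAfter (r.get i) = r.zerosFrom (i + 1) := by
  rw [zerosAfter, zerosFrom]
  apply Finset.card_bij fun j _ => j.val
  · rintro j hj
    simp only [Finset.mem_filter, Finset.mem_univ, true_and, letter_eq_get] at hj
    obtain ⟨hj0, i', hij, hi⟩ := hj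
    have := r.get_inj hi (hi ▸ h)
    rw [Finset.mem_filter, Finset.mem_Ico]
    exact ⟨⟨by rw [← this]; exact hij, j.isLt⟩, hj0⟩
  · exact fun _ _ _ _ => Fin.ext
  · intro j hj
    rw [Finset.mem_filter, Finset.mem_Ico] at hj
    refine ⟨⟨j, hj.1.2⟩, ?_, rfl⟩
    simp only [Finset.mem_filter, Finset.mem_univ, true_and, letter_eq_get]
    exact ⟨hj.2, ⟨i, r.lt_of_get_ne_zero h⟩, hj.1.1, rfl⟩

/-- The relation `≤_I` in terms of positions: every nonzero letter of `r`, at the position `i`,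
occurs in `u`, at a position `p`, and what follows it in `u` still follows it in `r`. -/
theorem LEI_iff {r u : Rook n} : r.LEI u ↔ ∀ i, r.get i ≠ 0 → ∃ p, u.get p = r.get i ∧
    u.zerosFrom (p + 1) ≤ r.zerosFrom (i + 1) ∧
    ∀ q, p < q → 0 < u.get q → u.get q < u.get p → ∃ j, i < j ∧ r.get j = u.get q := by
  constructor
  · rintro ⟨hs, hinv, hz⟩ i hi
    obtain ⟨-, p, hp⟩ := mem_supp_iff.1 (hs (get_mem_supp hi))
    refine ⟨p, hp, ?_, fun q hpq hq0 hq => ?_⟩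
    · have := hz _ (get_mem_supp hi)
      rwa [zerosAfter_get hi, ← hp, zerosAfter_get (hp ▸ hi)] at this
    · have h1 : (u.get p, u.get q) ∈ u.inv := mem_inv_iff.2 ⟨p, q, hpq, hq, hq0, rfl, rfl⟩
      obtain ⟨i', j, hij, -, -, hi', hj⟩ :=
        mem_inv_iff.1 (hinv ⟨h1, show u.get p ∈ r.supp from hp ▸ get_mem_supp hi⟩)
      obtain rfl : i = i' := r.get_inj (hp.symm.trans hi'.symm) hi
      exact ⟨j, hij, hj⟩
  · intro h
    refine ⟨fun l hl => ?_, ?_, fun l hl => ?_⟩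
    · obtain ⟨hl0, i, rfl⟩ := mem_supp_iff.1 hl
      obtain ⟨p, hp, -⟩ := h i hl0
      exact mem_supp_iff.2 ⟨hl0, p, hp⟩
    · rintro ⟨b, a⟩ ⟨hba, hb⟩
      obtain ⟨p, q, hpq, hab, ha, rfl, rfl⟩ := mem_inv_iff.1 hba
      obtain ⟨hb0, i, hi⟩ := mem_supp_iff.1 hb
      obtain ⟨p', hp', -, h3⟩ := h i (hi ▸ hb0)
      obtain rfl : p = p' := u.get_inj (hi.symm.trans hp'.symm) hb0
      obtain ⟨j, hij, hj⟩ := h3 q hpq ha hab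
      exact mem_inv_iff.2 ⟨i, j, hij, hab, ha, hi, hj⟩
    · obtain ⟨hl0, i, rfl⟩ := mem_supp_iff.1 hl
      obtain ⟨p, hp, hz, -⟩ := h i hl0
      rw [zerosAfter_get hl0, ← hp, zerosAfter_get (hp ▸ hl0)]
      exact hz

theorem LEI.refl (r : Rook n) : r.LEI r := ⟨subset_rfl, fun _ h => h.1, fun _ _ => le_rfl⟩

theorem LEI.trans {r u v : Rook n} (h₁ : r.LEI u) (h₂ : u.LEI v) : r.LEI v :=
  ⟨h₁.1.trans h₂.1, fun _ hp => h₁.2.1 ⟨h₂.2.1 ⟨hp.1, h₁.1 hp.2⟩, hp.2⟩,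
    fun l hl => (h₂.2.2 l (h₁.1 hl)).trans (h₁.2.2 l hl)⟩

/-- Let `r ≤_I u` have the same letters. Suppose that the nonzero letters of every ascent of `u` are
in the same order in `r`, and that a letter that follows a zero of `u` has no more zeros after it in
`r` than in `u`. Then no ascent of `u` can be exchanged without leaving the rooks above `r`, and
`r = u`. The proof shows that a first position where they differ is impossible, by comparing the
numbers of zeros from there on. -/
theorem LEI.eq_of_forall_ascent {r u : Rook n} (h : r.LEI u)
    (hs : ∀ p, u.get p ≠ 0 → ∃ i, r.get i = u.get p)
    (hpos : ∀ p i j, u.get p ≠ 0 → u.get p < u.get (p + 1) → r.get i = u.get p →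
      r.get j = u.get (p + 1) → i < j)
    (hzero : ∀ p j, u.get p = 0 → u.get (p + 1) ≠ 0 → r.get j = u.get (p + 1) →
      r.zerosFrom (j + 1) ≤ u.zerosFrom (p + 2)) : r = u := by
  rw [LEI_iff] at h
  have hT : r.zerosFrom 0 = u.zerosFrom 0 :=
    le_antisymm (zerosFrom_zero_le hs) (zerosFrom_zero_le fun i hi => (h i hi).imp fun _ h => h.1)
  apply ext_get
  intro i hi
  induction i using Nat.strong_induction_on with
  | _ i ih =>
  -- The rooks have the same number of zeros, and they agree before the position `i`.
  have hW : r.zerosFrom i = u.zerosFrom i := by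
    clear hpos hzero hs h
    induction i with
    | zero => exact hT
    | succ i ih' =>
      have h1 := ih' (fun m hm => ih m (by omega)) (by omega)
      rw [zerosFrom_eq r (by omega), zerosFrom_eq u (by omega), ih i (by omega) (by omega)] at h1
      omega
  have hr := r.zerosFrom_eq hi
  have hu := u.zerosFrom_eq hi
  by_cases hri : r.get i = 0
  · by_contra hne
    have hui : u.get i ≠ 0 := fun h' => hne (hri.trans h'.symm)
    rw [if_pos hri] at hr
    rw [if_neg hui] at hu
    obtain ⟨p, hp⟩ := hs i hui
    have hp0 : r.get p ≠ 0 := hp ▸ hui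
    have hip : i < p := by
      rcases lt_trichotomy i p with h' | rfl | h'
      · exact h'
      · exact absurd hp hne
      · have := u.get_inj ((ih p h' (by omega)).symm.trans hp) (by rwa [← ih p h' (by omega)])
        omega
    obtain ⟨p', hp', hz, -⟩ := h p hp0
    obtain rfl : p' = i := u.get_inj (hp'.trans hp) (hp' ▸ hp0)
    have := r.zerosFrom_anti (i := p' + 1) (j := p + 1) (by omega)
    omega
  · -- The letter of `r` at `i` is at a position `p > i` in `u`. The letter before it in `u` is `0`,
    -- since it would be at a position `j < i` in `r` otherwise, where `r` and `u` agree.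
    by_contra hne
    rw [if_neg hri] at hr
    obtain ⟨p, hp, -, -⟩ := h i hri
    have hip : i < p := by
      rcases lt_trichotomy i p with h' | rfl | h'
      · exact h'
      · exact absurd hp.symm hne
      · have := r.get_inj ((ih p h' (by omega)).trans hp) (by rwa [ih p h' (by omega), hp])
        omega
    obtain ⟨p, rfl⟩ : ∃ p', p = p' + 1 := ⟨p - 1, by omega⟩
    have hpn := u.lt_of_get_ne_zero (hp ▸ hri)
    by_cases hc : u.get p = 0
    · have h1 := hzero p i hc (hp ▸ hri) hp.symm
      have h2 := u.zerosFrom_eq (i := p) (by omega)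
      rw [if_pos hc] at h2
      have h3 := u.zerosFrom_anti (i := i) (j := p) (by omega)
      have h4 := u.zerosFrom_anti (i := p + 1) (j := p + 2) (by omega)
      omega
    · obtain ⟨j, hj⟩ := hs p hc
      have hji : j < i := by
        rcases lt_trichotomy (u.get p) (u.get (p + 1)) with h' | h' | h'
        · exact hpos p j i hc h' hj hp.symm
        · have := u.get_inj h' hc
          omega
        · obtain ⟨p', hp', -, hq⟩ := h j (hj ▸ hc)
          obtain rfl : p' = p := u.get_inj (hp'.trans hj) (hp'.trans hj ▸ hc)
          obtain ⟨i', hi', hi''⟩ := hq (p' + 1) (by omega) (by omega) h'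
          obtain rfl : i = i' := r.get_inj (hp.symm.trans hi''.symm) hri
          exact hi'
      have := u.get_inj ((ih j hji (by omega)).symm.trans hj) (by rwa [← ih j hji (by omega), hj])
      omega

theorem LEI.antisymm {r u : Rook n} (h₁ : r.LEI u) (h₂ : u.LEI r) : r = u := by
  have h₂' := LEI_iff.1 h₂
  refine h₁.eq_of_forall_ascent (fun p hp => (h₂' p hp).imp fun _ h => h.1) ?_ ?_
  · intro p i j hp0 hp hi hj
    by_contra hij
    obtain ⟨j', hj', -, hq⟩ := h₂' (p + 1) (by omega)
    obtain rfl : j' = j := r.get_inj (hj'.trans hj.symm) (by omega)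
    have hne : i ≠ j' := by rintro rfl; omega
    obtain ⟨p', hp', hp''⟩ := hq i (by omega) (by omega) (by omega)
    have := u.get_inj (hp''.trans hi) (by omega)
    omega
  · intro p j _ hp hj
    obtain ⟨j', hj', hz, -⟩ := h₂' (p + 1) hp
    obtain rfl : j' = j := r.get_inj (hj'.trans hj.symm) (hj' ▸ hp)
    exact hz

/-! ### The order `≤_I` and the action -/

theorem zerosFrom_actP1 (u : Rook n) {i : ℕ} (hi : 1 ≤ i) :
    (u.act (ZeroRook.piZero n 0)).zerosFrom i = u.zerosFrom i :=
  zerosFrom_congr fun j hj => by rw [get_act_zero, if_neg (by omega)]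

theorem LEI_act_zero (u : Rook n) : (u.act (ZeroRook.piZero n 0)).LEI u := by
  rw [LEI_iff]
  intro i hi
  have hi0 : i ≠ 0 := by
    rintro rfl
    exact hi (by rw [get_act_zero, if_pos rfl])
  refine ⟨i, by rw [get_act_zero, if_neg hi0], (zerosFrom_actP1 u (by omega)).ge,
    fun q hq _ _ => ⟨q, hq, by rw [get_act_zero, if_neg (by omega)]⟩⟩

/-- The first letter of `u` can be replaced by `0` if it does not occur in `r`. -/
theorem LEI.act_zero {r u : Rook n} (h : r.LEI u) (h0 : ∀ i, r.get i ≠ 0 → r.get i ≠ u.get 0) :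
    r.LEI (u.act (ZeroRook.piZero n 0)) := by
  rw [LEI_iff] at h ⊢
  intro i hi
  obtain ⟨p, hp, hz, hq⟩ := h i hi
  have hp0 : p ≠ 0 := by
    rintro rfl
    exact h0 i hi hp.symm
  refine ⟨p, by rw [get_act_zero, if_neg hp0, hp], ?_, fun q hpq => ?_⟩
  · rwa [zerosFrom_actP1 u (by omega)]
  · rw [get_act_zero, get_act_zero, if_neg hp0, if_neg (by omega)]
    exact hq q hpq

theorem get_act_of_le (u : Rook n) {k : ℕ} (hkn : k + 1 < n) (h : u.get k < u.get (k + 1))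
    (i : ℕ) : (u.act (ZeroRook.piZero n (k + 1))).get i =
      if i = k then u.get (k + 1) else if i = k + 1 then u.get k else u.get i := by
  rw [get_act_of_pos u (by omega) hkn]
  grind

theorem act_of_ge (u : Rook n) {k : ℕ} (hkn : k + 1 < n) (h : u.get (k + 1) ≤ u.get k) :
    u.act (ZeroRook.piZero n (k + 1)) = u := by
  apply ext_get
  intro i _
  rw [get_act_of_pos u (by omega) hkn]
  grind

/-- Exchanging an ascent changes the number of zeros only from its second position on. -/
theorem zerosFrom_act (u : Rook n) {k : ℕ} (hkn : k + 1 < n) (h : u.get k < u.get (k + 1))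
    {i : ℕ} (hi : i ≠ k + 1) :
    (u.act (ZeroRook.piZero n (k + 1))).zerosFrom i = u.zerosFrom i := by
  have hv := u.get_act_of_le hkn h
  have hgt {i : ℕ} (hi : k + 1 < i) :
      (u.act (ZeroRook.piZero n (k + 1))).zerosFrom i = u.zerosFrom i :=
    zerosFrom_congr fun j hj => by rw [hv, if_neg (by omega), if_neg (by omega)]
  rcases Nat.lt_or_ge (k + 1) i with h' | h'
  · exact hgt h'
  · replace h' : i ≤ k := by omega
    induction h' using Nat.decreasingInduction with
    | self =>
      have h1 := u.zerosFrom_eq (i := k) (by omega)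
      have h2 := u.zerosFrom_eq hkn
      rw [zerosFrom_eq _ (by omega : k < n), zerosFrom_eq _ hkn, hgt (by omega), hv, hv,
        if_pos rfl, if_neg (Nat.succ_ne_self k), if_pos rfl]
      omega
    | of_succ i hik ih =>
      rw [zerosFrom_eq _ (by omega : i < n), u.zerosFrom_eq (by omega : i < n), ih (by omega), hv,
        if_neg hik.ne, if_neg (by omega : i ≠ k + 1)]

theorem LEI_act_succ (u : Rook n) {k : ℕ} (hkn : k + 1 < n) :
    (u.act (ZeroRook.piZero n (k + 1))).LEI u := by
  rcases Nat.lt_or_ge (u.get k) (u.get (k + 1)) with h | h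
  · have hv := u.get_act_of_le hkn h
    have hz := fun i => u.zerosFrom_act hkn h (i := i)
    rw [LEI_iff]
    intro i hi
    rcases eq_or_ne i k with rfl | hik
    · refine ⟨i + 1, by rw [hv, if_pos rfl], ?_, fun q hq _ _ =>
        ⟨q, by omega, by rw [hv, if_neg (by omega), if_neg (by omega)]⟩⟩
      rw [← hz _ (by omega)]
      exact zerosFrom_anti _ (by omega)
    · rcases eq_or_ne i (k + 1) with rfl | hik'
      · refine ⟨k, by rw [hv, if_neg (by omega), if_pos rfl], ?_, fun q hq _ hq' => ?_⟩
        · rw [hz _ (by omega), u.zerosFrom_eq hkn, if_neg (by omega)]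
          exact le_rfl
        · have : q ≠ k + 1 := by rintro rfl; omega
          exact ⟨q, by omega, by rw [hv, if_neg (by omega), if_neg (by omega)]⟩
      · refine ⟨i, by rw [hv, if_neg hik, if_neg hik'], (hz _ (by omega)).ge, fun q hq _ _ => ?_⟩
        rcases eq_or_ne q k with rfl | hqk
        · exact ⟨q + 1, by omega, by rw [hv, if_neg (by omega), if_pos rfl]⟩
        · rcases eq_or_ne q (k + 1) with rfl | hqk'
          · exact ⟨k, by omega, by rw [hv, if_pos rfl]⟩
          · exact ⟨q, hq, by rw [hv, if_neg hqk, if_neg hqk']⟩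
  · rw [act_of_ge u hkn h]
    exact LEI.refl u

theorem LEI_act (u : Rook n) (x : ZeroRook n) : (u.act x).LEI u := by
  induction x using ZeroRook.induction_piZero with
  | one => simpa using LEI.refl u
  | mul_piZero x k hk ih =>
    rw [act_mul]
    refine LEI.trans ?_ ih
    cases k with
    | zero => exact LEI_act_zero _
    | succ k => exact LEI_act_succ _ hk

/-- Exchanging an ascent of `u` preserves `r ≤_I u` if the new inversion, or the zero that is moved
to the right, is allowed by `r`. -/
theorem LEI.act_succ {r u : Rook n} (h : r.LEI u) {k : ℕ} (hkn : k + 1 < n)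
    (hk : u.get k < u.get (k + 1))
    (hinv : u.get k ≠ 0 → ∀ i, r.get i = u.get (k + 1) → ∃ j, i < j ∧ r.get j = u.get k)
    (hzero : u.get k = 0 → ∀ i, r.get i = u.get (k + 1) →
      u.zerosFrom (k + 2) < r.zerosFrom (i + 1)) :
    r.LEI (u.act (ZeroRook.piZero n (k + 1))) := by
  have hv := u.get_act_of_le hkn hk
  have hz := fun i => u.zerosFrom_act hkn hk (i := i)
  rw [LEI_iff] at h ⊢
  intro i hi
  obtain ⟨p, hp, hpz, hq⟩ := h i hi
  rcases eq_or_ne p (k + 1) with rfl | hpk'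
  · refine ⟨k, by rw [hv, if_pos rfl, hp], ?_, fun q hkq hq0 hq' => ?_⟩
    · rw [zerosFrom_eq _ hkn, hz _ (by omega), hv, if_neg (Nat.succ_ne_self k), if_pos rfl]
      split_ifs with h0
      · exact hzero h0 i hp.symm
      · exact hpz
    · rcases eq_or_ne q (k + 1) with rfl | hqk
      · rw [hv, if_neg (by omega), if_pos rfl] at hq0 ⊢
        exact hinv (by omega) i hp.symm
      · rw [hv, if_neg (by omega), if_neg hqk] at hq0 hq' ⊢
        rw [hv, if_pos rfl] at hq'
        exact hq q (by omega) hq0 hq'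
  · rcases eq_or_ne p k with rfl | hpk
    · refine ⟨p + 1, by rw [hv, if_neg (by omega), if_pos rfl, hp], ?_, fun q hkq => ?_⟩
      · rw [hz _ (by omega)]
        exact (zerosFrom_anti _ (by omega)).trans hpz
      · rw [hv q, if_neg (by omega), if_neg (by omega), hv, if_neg (by omega), if_pos rfl]
        exact hq q (by omega)
    · refine ⟨p, by rw [hv, if_neg hpk, if_neg hpk', hp], by rwa [hz _ (by omega)],
        fun q hpq => ?_⟩
      rw [hv p, if_neg hpk, if_neg hpk']
      rcases eq_or_ne q k with rfl | hqk
      · rw [hv, if_pos rfl]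
        exact hq _ (by omega)
      · rcases eq_or_ne q (k + 1) with rfl | hqk'
        · rw [hv, if_neg (by omega), if_pos rfl]
          exact hq _ (by omega)
        · rw [hv, if_neg hqk, if_neg hqk']
          exact hq _ hpq

/-- If `r <_I u`, then some generator moves `u` to another rook above `r`. -/
theorem LEI.exists_act {r u : Rook n} (h : r.LEI u) (hne : r ≠ u) :
    ∃ k, r.LEI (u.act (ZeroRook.piZero n k)) ∧ u.act (ZeroRook.piZero n k) ≠ u := by
  have hasc {k : ℕ} (hkn : k + 1 < n) (hk : u.get k < u.get (k + 1)) :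
      u.act (ZeroRook.piZero n (k + 1)) ≠ u := by
    intro he
    have := u.get_act_of_le hkn hk k
    rw [he, if_pos rfl] at this
    omega
  by_cases hs : ∃ p, u.get p ≠ 0 ∧ ∀ i, r.get i ≠ u.get p
  · -- The leftmost letter of `u` that does not occur in `r` is moved to the left, or removed.
    classical
    obtain ⟨hp0, hpr⟩ := Nat.find_spec hs
    have hmin := fun m => Nat.find_min hs (m := m)
    generalize Nat.find hs = p at hp0 hpr hmin
    cases p with
    | zero =>
      refine ⟨0, h.act_zero fun i _ => hpr i, fun he => hp0 ?_⟩
      have := u.get_act_zero 0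
      rwa [he, if_pos rfl] at this
    | succ p =>
      have hpn := u.lt_of_get_ne_zero hp0
      have hlt : u.get p < u.get (p + 1) := by
        by_contra hge
        have hne' : u.get p ≠ u.get (p + 1) := fun h' => by
          have := u.get_inj h' (h' ▸ hp0)
          omega
        have h1 := hmin p (by omega)
        push Not at h1
        obtain ⟨i, hi⟩ := h1 (by omega)
        obtain ⟨p', hp', -, hq⟩ := LEI_iff.1 h i (by omega)
        obtain rfl : p' = p := u.get_inj (hp'.trans hi) (by omega)
        obtain ⟨j, -, hj⟩ := hq (p' + 1) (by omega) (by omega) (by omega)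
        exact hpr j hj
      exact ⟨p + 1, h.act_succ hpn hlt (fun _ i hi => absurd hi (hpr i))
        (fun _ i hi => absurd hi (hpr i)), hasc hpn hlt⟩
  · push Not at hs
    by_contra hstuck
    push Not at hstuck
    refine hne (h.eq_of_forall_ascent hs ?_ ?_)
    · intro p i j hp0 hlt hi hj
      by_contra hij
      have hpn := u.lt_of_get_ne_zero (i := p + 1) (by omega)
      refine hasc hpn hlt (hstuck _ (h.act_succ hpn hlt (fun _ j' hj' => ?_) fun h0 => ?_))
      · obtain rfl : j' = j := r.get_inj (hj'.trans hj.symm) (by omega)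
        have : i ≠ j' := by rintro rfl; omega
        exact ⟨i, by omega, hi⟩
      · exact absurd h0 hp0
    · intro p j hp0 hp1 hj
      by_contra hlt
      have hpn := u.lt_of_get_ne_zero hp1
      refine hasc hpn (by omega) (hstuck _ (h.act_succ hpn (by omega) (fun h0 => ?_)
        fun _ j' hj' => ?_))
      · exact absurd hp0 h0
      · obtain rfl : j' = j := r.get_inj (hj'.trans hj.symm) (by omega)
        omega

theorem LEI.exists_act_eq {r u : Rook n} (h : r.LEI u) : ∃ x, u.act x = r := by
  have wf : WellFounded fun v u : Rook n => v.LEI u ∧ v ≠ u := by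
    have : IsTrans (Rook n) fun v u => v.LEI u ∧ v ≠ u :=
      ⟨fun v u w h₁ h₂ => ⟨h₁.1.trans h₂.1, fun e => h₁.2 (h₁.1.antisymm (e ▸ h₂.1))⟩⟩
    have : Std.Irrefl fun v u : Rook n => v.LEI u ∧ v ≠ u := ⟨fun _ h => h.2 rfl⟩
    exact Finite.wellFounded_of_trans_of_irrefl _
  induction u using wf.induction with
  | _ u ih =>
  by_cases hne : r = u
  · exact ⟨1, by rw [hne, act_one]⟩
  · obtain ⟨k, hk, hk'⟩ := h.exists_act hne
    obtain ⟨x, hx⟩ := ih _ ⟨LEI_act _ _, hk'⟩ hk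
    exact ⟨ZeroRook.piZero n k * x, by rw [act_mul, hx]⟩

end Rook

/-! ### Green's relations -/

namespace Green

variable {M : Type*} [Monoid M]

theorem RLE_iff {x y : M} : RLE x y ↔ ∃ m, x = y * m := by
  constructor
  · exact fun h => h ⟨1, (mul_one x).symm⟩
  · rintro ⟨m, rfl⟩ _ ⟨m', rfl⟩
    exact ⟨m * m', mul_assoc y m m'⟩

theorem RTrivial.eq_of_mul_eq (h : RTrivial M) {x y a b : M} (hx : x = y * a) (hy : y = x * b) :
    x = y :=
  h x y (Set.Subset.antisymm (RLE_iff.2 ⟨a, hx⟩) (RLE_iff.2 ⟨b, hy⟩))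

/-- The left ideals of a monoid are the right ideals of its opposite. -/
theorem RTrivial.lTrivial_of_equiv (h : RTrivial M) (e : M ≃* Mᵐᵒᵖ) : LTrivial M := by
  intro x y hxy
  obtain ⟨a, ha⟩ : x ∈ leftIdeal y := hxy ▸ ⟨1, (one_mul x).symm⟩
  obtain ⟨b, hb⟩ : y ∈ leftIdeal x := hxy ▸ ⟨1, (one_mul y).symm⟩
  have hxa : (e x).unop = (e y).unop * (e a).unop := by
    rw [← MulOpposite.unop_mul, ← map_mul, ← ha]
  have hyb : (e y).unop = (e x).unop * (e b).unop := by
    rw [← MulOpposite.unop_mul, ← map_mul, ← hb]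
  exact e.injective (MulOpposite.unop_injective (h.eq_of_mul_eq hxa hyb))

theorem eq_pow_mul_mul_pow {x a b : M} (h : x = a * x * b) (k : ℕ) : x = a ^ k * x * b ^ k := by
  induction k with
  | zero => simp
  | succ k ih =>
    calc x = a ^ k * (a * x * b) * b ^ k := by rw [← h, ← ih]
      _ = a ^ (k + 1) * x * b ^ (k + 1) := by simp only [pow_succ, pow_succ' b, mul_assoc]

/-- In a finite monoid, `x = axb` implies `x = xb^k` for some positive `k`. -/
theorem exists_eq_mul_pow [Finite M] {x a b : M} (h : x = a * x * b) :
    ∃ k, x = x * b ^ (k + 1) := by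
  obtain ⟨i, j, hij, he⟩ : ∃ i j, i < j ∧ x * b ^ i = x * b ^ j := by
    obtain ⟨i, j, hne, he⟩ := Finite.exists_ne_map_eq_of_infinite fun k : ℕ => x * b ^ k
    rcases lt_or_gt_of_ne hne with h | h
    · exact ⟨i, j, h, he⟩
    · exact ⟨j, i, h, he.symm⟩
  obtain ⟨k, rfl⟩ := Nat.exists_eq_add_of_lt hij
  refine ⟨k, ?_⟩
  calc x = a ^ i * (x * b ^ i) := by rw [← mul_assoc, ← eq_pow_mul_mul_pow h]
    _ = a ^ i * x * b ^ i * b ^ (k + 1) := by rw [he, add_assoc, pow_add]; simp only [mul_assoc]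
    _ = x * b ^ (k + 1) := by rw [← eq_pow_mul_mul_pow h]

/-- In a finite `R`-trivial monoid, right factors that can be undone act trivially. -/
theorem RTrivial.mul_eq_self [Finite M] (hR : RTrivial M) {x s d b : M} (h : x = s * x * (d * b)) :
    x * d = x := by
  obtain ⟨k, hk⟩ := exists_eq_mul_pow h
  refine hR.eq_of_mul_eq rfl (b := b * (d * b) ^ k) ?_
  rwa [← mul_assoc, mul_assoc x d b, mul_assoc, ← pow_succ']

theorem RTrivial.jTrivial [Finite M] (hR : RTrivial M) (e : M ≃* Mᵐᵒᵖ) : JTrivial M := by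
  intro x y hxy
  obtain ⟨a, b, hx⟩ : x ∈ twoSidedIdeal y := hxy ▸ ⟨1, 1, by simp⟩
  obtain ⟨c, d, hy⟩ : y ∈ twoSidedIdeal x := hxy ▸ ⟨1, 1, by simp⟩
  have h : x = (a * c) * x * (d * b) := by
    calc x = a * (c * x * d) * b := by rw [← hy, ← hx]
      _ = _ := by simp only [mul_assoc]
  have hd : x * d = x := hR.mul_eq_self h
  have hc : c * x = x := by
    have h' : (e x).unop = (e (d * b)).unop * (e x).unop * ((e c).unop * (e a).unop) := by
      conv_lhs => rw [h]
      simp only [map_mul, MulOpposite.unop_mul, mul_assoc]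
    apply e.injective
    apply MulOpposite.unop_injective
    rw [map_mul, MulOpposite.unop_mul]
    exact hR.mul_eq_self h'
  rw [hy, hc, hd]

end Green

namespace ZeroRook

variable {n : ℕ}

instance : Finite (ZeroRook n) := Finite.of_injective _ one_act_injective

theorem RLE_ofRook_iff (r u : Rook n) : Green.RLE (ofRook r) (ofRook u) ↔ r.LEI u := by
  rw [Green.RLE_iff]
  constructor
  · rintro ⟨x, hx⟩
    rw [ofRook_mul] at hx
    rw [← one_act_ofRook r, hx, one_act_ofRook]
    exact Rook.LEI_act u x
  · intro h
    obtain ⟨x, rfl⟩ := h.exists_act_eq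
    exact ⟨x, (ofRook_mul u x).symm⟩

theorem rTrivial (n : ℕ) : Green.RTrivial (ZeroRook n) := by
  intro x y h
  rw [← ofRook_one_act x, ← ofRook_one_act y] at h ⊢
  rw [((RLE_ofRook_iff _ _).1 h.subset).antisymm ((RLE_ofRook_iff _ _).1 h.superset)]

end ZeroRook

theorem mainTheorem3 (n : ℕ) :
    -- the presented monoid is the monoid of operators on rooks, and `π_r` is the unique element
    -- that sends the identity rook to `r`
    (∃ Φ : ZeroRook n ≃* rookOperators n,
      (∀ (k : ℕ) (h₁ : 1 ≤ k) (h₂ : k < n),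
        (Φ (ZeroRook.pi k h₁ h₂) : (Function.End (Rook n))ᵐᵒᵖ) =
          MulOpposite.op (Rook.actPi k h₁ h₂)) ∧
      (∀ h : 1 ≤ n,
        (Φ (ZeroRook.P 1 le_rfl h) : (Function.End (Rook n))ᵐᵒᵖ) = MulOpposite.op Rook.actP1) ∧
      (∀ (r : Rook n) (x : ZeroRook n),
        (Φ x : (Function.End (Rook n))ᵐᵒᵖ).unop (Rook.one n) = r ↔ x = ZeroRook.ofRook r)) ∧
    -- the combinatorial characterization of the `R`-preorder
    (∀ r u : Rook n, Green.RLE (ZeroRook.ofRook r) (ZeroRook.ofRook u) ↔ Rook.LEI r u) ∧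
    Green.RTrivial (ZeroRook n) ∧
    Nonempty (ZeroRook n ≃* (ZeroRook n)ᵐᵒᵖ) ∧
    Green.LTrivial (ZeroRook n) ∧
    Green.JTrivial (ZeroRook n) := by
  refine ⟨⟨ZeroRook.equivOperators n, fun k h₁ h₂ => ?_, fun h => ?_, fun r x => ?_⟩,
    ZeroRook.RLE_ofRook_iff, ZeroRook.rTrivial n, ⟨ZeroRook.equivOpposite n⟩,
    (ZeroRook.rTrivial n).lTrivial_of_equiv (ZeroRook.equivOpposite n),
    (ZeroRook.rTrivial n).jTrivial (ZeroRook.equivOpposite n)⟩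
  · rw [ZeroRook.coe_equivOperators, ZeroRook.actHom_pi]
  · rw [ZeroRook.coe_equivOperators, ← ZeroRook.piZero_zero h, ZeroRook.actHom_piZero_zero]
  · rw [ZeroRook.coe_equivOperators]
    exact ZeroRook.one_act_eq_iff r x
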